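/- Let $n\ge 1$, $s\in(0,1)$, and let $\Omega\subset\mathbb R^n$ be a bounded domain (nonempty, open, connected; no regularity of $\partial\Omega$ is assumed). Let $H^s(\mathbb R^n)$ be the space of real-valued $u\in L^2(\mathbb R^n)$ with $|\xi|^s\mathcal F[u]\in L^2(\mathbb R^n)$, where $\mathcal F[u](\xi)=(2\pi)^{-n/2}\int_{\mathbb R^n}e^{-i\xi\cdot x}u(x)\,dx$, and let $$\widetilde H^s(\Omega)=\{u\in H^s(\mathbb R^n) : u=0 \text{ a.e. on } \mathbb R^n\setminus\overline\Omega\},\qquad \langle(-\Delta)^s u,v\rangle=\int_{\mathbb R^n}|\xi|^{2s}\,\mathcal F[u]\,\overline{\mathcal F[v]}\,d\xi .$$ The norm of $u$ in $\widetilde H^s(\Omega)$ is $\langle(-\Delta)^su,u\rangle^{1/2}$. Let $p\in(1,\infty)$ with $p>\frac{n}{2s}$. Then there is a constant $c\ge 0$ depending only on $n,s,p$ and $\Omega$ such that the following holds for all $\psi\in L^\infty(\Omega)$ and $f\in L^p(\Omega)$ for which the set $$K^s_\psi=\{v\in\widetilde H^s(\Omega): v\ge\psi \text{ a.e. on }\Omega\}$$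 is not empty. The function $f$ defines, through $\langle f,v\rangle=\int_\Omega f v\,dx$, a bounded linear functional on $\widetilde H^s(\Omega)$. There is a unique $\omega_f\in\widetilde H^s(\Omega)$ with $\langle(-\Delta)^s\omega_f,v\rangle=\langle f,v\rangle$ for all $v\in\widetilde H^s(\Omega)$, and a unique $u\in K^s_\psi$ with $$\langle(-\Delta)^s u-f,\,v-u\rangle\ge 0\qquad\text{for all } v\in K^s_\psi .$$ Moreover $u\in L^\infty(\Omega)$ and $$\max\{\psi,\omega_f\}\le u\le \|\psi^+\|_{L^\infty(\Omega)}+c\,\|f^+\|_{L^p(\Omega)}\quad\text{a.e. in }\Omega ,$$ where $g^+=\max\{g,0\}$. In particular, if $f=0$, then $\psi^+\le u\le\|\psi^+\|_{L^\infty(\Omega)}$ a.e. in $\Omega$. -/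

import Mathlib

open MeasureTheory FourierTransform
open scoped ENNReal

noncomputable section

namespace FracObstacle

/-- Euclidean space `ℝⁿ`. -/
abbrev Rn (n : ℕ) : Type := EuclideanSpace ℝ (Fin n)

/-- The space `L²(ℝⁿ)` of real-valued functions. -/
abbrev L2 (n : ℕ) : Type := Lp ℝ 2 (volume : Measure (Rn n))

/-- The Fourier transform `𝓕 u(ξ) = ∫ e^{-2π i ξ·x} u(x) dx` of a real-valued `u ∈ L²(ℝⁿ)`
(defined on `L²` by Plancherel). -/
def fourierL2 {n : ℕ} (u : L2 n) : Lp ℂ 2 (volume : Measure (Rn n)) :=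
  𝓕 (Complex.ofRealCLM.compLp u)

/-- The symbol of `(-Δ)^σ`. With the normalization `e^{-2π i ξ·x}` of the Fourier transform it is
`(2π|ξ|)^{2σ}`; the change of variables `η = 2πξ` turns it into `|η|^{2σ}` for the unitary
transform with kernel `(2π)^{-n/2} e^{-i η·x}`. -/
def symbol {n : ℕ} (σ : ℝ) (ξ : Rn n) : ℝ := (2 * Real.pi * ‖ξ‖) ^ (2 * σ)

/-- `u ∈ Hˢ(ℝⁿ)`: `u ∈ L²(ℝⁿ)` and `(-Δ)^{s/2} u ∈ L²(ℝⁿ)`, that is, the Fourier transform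
`|2πξ|^s 𝓕 u(ξ)` of `(-Δ)^{s/2} u` is square integrable. -/
def MemHs {n : ℕ} (s : ℝ) (u : L2 n) : Prop :=
  MemLp (fun ξ : Rn n => (symbol (s / 2) ξ : ℂ) * fourierL2 u ξ) 2 volume

/-- The space `H̃ˢ(Ω)` of all `u ∈ Hˢ(ℝⁿ)` that vanish a.e. outside the closure of `Ω`. -/
def HsTilde {n : ℕ} (s : ℝ) (Ω : Set (Rn n)) : Set (L2 n) :=
  {u | MemHs s u ∧ ∀ᵐ x ∂(volume : Measure (Rn n)), x ∉ closure Ω → u x = 0}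

/-- The duality product `⟨(-Δ)^s u, v⟩ = ∫ |2πξ|^{2s} 𝓕 u(ξ) conj(𝓕 v(ξ)) dξ`, which is a real
number for real-valued `u, v ∈ Hˢ(ℝⁿ)`. -/
def fracForm {n : ℕ} (s : ℝ) (u v : L2 n) : ℝ :=
  (∫ ξ : Rn n, (symbol s ξ : ℂ) * (fourierL2 u ξ * (starRingEnd ℂ) (fourierL2 v ξ))).re

/-- The duality product `⟨f, v⟩ = ∫_Ω f v dx` of a function `f` on `Ω` with `v`. -/
def pairing {n : ℕ} (Ω : Set (Rn n)) (f : Rn n → ℝ) (v : L2 n) : ℝ :=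
  ∫ x in Ω, f x * v x

/-- The function `f` on `Ω` belongs to the dual of `H̃ˢ(Ω)`: the functional `v ↦ ∫_Ω f v dx` is well
defined on `H̃ˢ(Ω)` and bounded with respect to the norm `‖(-Δ)^{s/2} v‖₂ = ⟨(-Δ)^s v, v⟩^{1/2}`. -/
def MemDual {n : ℕ} (s : ℝ) (Ω : Set (Rn n)) (f : Rn n → ℝ) : Prop :=
  ∃ C : ℝ, ∀ v ∈ HsTilde s Ω,
    IntegrableOn (fun x => f x * v x) Ω volume ∧ |pairing Ω f v| ≤ C * √(fracForm s v v)

/-- The convex set `K_ψ^s` of all `v ∈ H̃ˢ(Ω)` with `v ≥ ψ` a.e. on `Ω`. -/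
def obstacleSet {n : ℕ} (s : ℝ) (Ω : Set (Rn n)) (ψ : Rn n → ℝ) : Set (L2 n) :=
  {v | v ∈ HsTilde s Ω ∧ ∀ᵐ x ∂(volume.restrict Ω), ψ x ≤ v x}

/-- `u` solves the variational inequality
`u ∈ K_ψ^s`, `⟨(-Δ)^s u - f, v - u⟩ ≥ 0` for all `v ∈ K_ψ^s`. -/
def SolvesObstacle {n : ℕ} (s : ℝ) (Ω : Set (Rn n)) (ψ f : Rn n → ℝ) (u : L2 n) : Prop :=
  u ∈ obstacleSet s Ω ψ ∧
    ∀ v ∈ obstacleSet s Ω ψ, 0 ≤ fracForm s u (v - u) - pairing Ω f (v - u)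

/-- `ω` solves `(-Δ)^s ω = f` in `Ω`, `ω ∈ H̃ˢ(Ω)`, as an identity in the dual of `H̃ˢ(Ω)`. -/
def SolvesDirichlet {n : ℕ} (s : ℝ) (Ω : Set (Rn n)) (f : Rn n → ℝ) (ω : L2 n) : Prop :=
  ω ∈ HsTilde s Ω ∧ ∀ v ∈ HsTilde s Ω, fracForm s ω v = pairing Ω f v

/-- The norm `‖g‖_p` of `L^p(Ω)`. -/
def normLp {n : ℕ} (Ω : Set (Rn n)) (p : ℝ≥0∞) (g : Rn n → ℝ) : ℝ :=
  (eLpNorm g p (volume.restrict Ω)).toReal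

end FracObstacle

end

noncomputable section

namespace FracObstacle

open Filter Topology

/-! Everything rests on rewriting the energy, given on the Fourier side, as a multiple of the
Gagliardo integral ∬ |u(x+h) - u(x)|² |h|^{-n-2s} dx dh (`exists_gagliardo_eq`). In that form a
1-Lipschitz map fixing 0 visibly cannot raise the energy (`energy_compLp_le`), and a function
supported on a set of measure m satisfies ‖u‖₂² ≤ C m^{2s/n} times its energy (`exists_faberKrahn`).
The latter contains the Poincaré inequality on H̃ˢ(Ω). Applied to (|u| - t)⁺ it also gives a
recursion for the distribution function of u, and from it an L^r bound with some r > 2p', where p'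
is the conjugate exponent (`exists_sobolev`).

By Poincaré, u ↦ |2πξ|^s 𝓕u embeds H̃ˢ(Ω) as a complete subspace of L². Riesz's theorem there yields
ω_f, and the solution u of the obstacle problem is the projection of ω_f onto K_ψ.

The bounds come from test functions. The fold x ↦ k - |x - k| with k ≥ 0 is 1-Lipschitz and fixes 0,
and comparing the energies of w and of its fold gives ⟨(-Δ)^s b, b⟩ ≤ ⟨(-Δ)^s w, b⟩ for b = (w - k)⁺
(`exists_truncation`). With w = ω_f - u, k = 0 and the competitor u + b this forces ω_f ≤ u. With w
= u, k ≥ ‖ψ⁺‖_∞ and the competitor min(u, k), it bounds the energy of (u - k)⁺ by ∫ f (u - k)⁺.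
Hölder, Sobolev and Chebyshev then give |{u > h}| ≤ (A/(h-k))^r |{u > k}|^γ, with A proportional to
‖f⁺‖_p and γ = r/p' - 1 > 1 (`measureReal_superlevel_le`). Stampacchia's lemma concludes. -/

/-! ### Translations under the Fourier transform -/

/-- Multiplication by the character `ξ ↦ e^{2πi h·ξ}`. -/
theorem memLp_phase_mul {n : ℕ} (h : Rn n) (v : Lp ℂ 2 (volume : Measure (Rn n))) :
    MemLp (fun ξ => ((Real.fourierChar (inner ℝ h ξ) : Circle) : ℂ) * v ξ) 2 volume := by
  refine MemLp.of_le (Lp.memLp v) ?_ (by simp [Circle.norm_coe])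
  exact (by fun_prop : Continuous fun ξ : Rn n => ((Real.fourierChar (inner ℝ h ξ) : Circle) : ℂ)).aestronglyMeasurable.mul
    (Lp.aestronglyMeasurable v)

def phaseMul {n : ℕ} (h : Rn n) (v : Lp ℂ 2 (volume : Measure (Rn n))) :
    Lp ℂ 2 (volume : Measure (Rn n)) := (memLp_phase_mul h v).toLp

theorem coeFn_phaseMul {n : ℕ} (h : Rn n) (v : Lp ℂ 2 (volume : Measure (Rn n))) :
    phaseMul h v =ᵐ[volume] fun ξ => ((Real.fourierChar (inner ℝ h ξ) : Circle) : ℂ) * v ξ :=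
  (memLp_phase_mul h v).coeFn_toLp

theorem isometry_phaseMul {n : ℕ} (h : Rn n) : Isometry (phaseMul h) := by
  intro v v'
  rw [Lp.edist_def, Lp.edist_def]
  apply eLpNorm_congr_norm_ae
  filter_upwards [coeFn_phaseMul h v, coeFn_phaseMul h v'] with ξ h1 h2
  simp [h1, h2, ← mul_sub, Circle.norm_coe]

/-- Translation `v ↦ v(· + h)` on `L²`. -/
def shift {n : ℕ} {E : Type*} [NormedAddCommGroup E] (h : Rn n)
    (v : Lp E 2 (volume : Measure (Rn n))) : Lp E 2 (volume : Measure (Rn n)) :=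
  Lp.compMeasurePreserving (· + h) (measurePreserving_add_right volume h) v

theorem coeFn_shift {n : ℕ} {E : Type*} [NormedAddCommGroup E] (h : Rn n)
    (v : Lp E 2 (volume : Measure (Rn n))) : shift h v =ᵐ[volume] fun x => v (x + h) :=
  Lp.coeFn_compMeasurePreserving v (measurePreserving_add_right volume h)

/-- Both sides are continuous in `v`, so Schwartz functions suffice; there it is a translation of
the variable in the Fourier integral. -/
theorem fourier_shift {n : ℕ} (h : Rn n) (v : Lp ℂ 2 (volume : Measure (Rn n))) :
    𝓕 (shift h v) = phaseMul h (𝓕 v) := by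
  refine DenseRange.induction_on (p := fun v => 𝓕 (shift h v) = phaseMul h (𝓕 v))
    (SchwartzMap.denseRange_toLpCLM (E := Rn n) (F := ℂ) (p := 2) ENNReal.ofNat_ne_top) v ?_ ?_
  · refine isClosed_eq ?_ ?_
    · exact (Lp.fourierTransformₗᵢ (Rn n) ℂ).continuous.comp
        (Lp.isometry_compMeasurePreserving (measurePreserving_add_right volume h)).continuous
    · exact (isometry_phaseMul h).continuous.comp (Lp.fourierTransformₗᵢ (Rn n) ℂ).continuous
  · intro φ
    have h1 : shift h (SchwartzMap.toLpCLM ℝ ℂ 2 volume φ)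
        = (SchwartzMap.compSubConstCLM ℂ (-h) φ).toLp 2 := by
      apply Lp.ext
      refine (coeFn_shift h _).trans ?_
      have h2 := (measurePreserving_add_right (volume : Measure (Rn n)) h).quasiMeasurePreserving.ae_eq_comp
        (SchwartzMap.coeFn_toLp φ 2 volume)
      filter_upwards [SchwartzMap.coeFn_toLp (SchwartzMap.compSubConstCLM ℂ (-h) φ) 2 volume, h2] with x h3 h4
      rw [h3]
      simpa using h4
    rw [h1, SchwartzMap.toLpCLM_apply, SchwartzMap.toLp_fourier_eq, SchwartzMap.toLp_fourier_eq]
    apply Lp.ext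
    filter_upwards [coeFn_phaseMul h ((𝓕 φ).toLp 2 volume), SchwartzMap.coeFn_toLp (𝓕 φ) 2 volume,
      SchwartzMap.coeFn_toLp (𝓕 (SchwartzMap.compSubConstCLM ℂ (-h) φ)) 2 volume] with ξ h2 h3 h4
    rw [h2, h3, h4, SchwartzMap.fourier_coe, SchwartzMap.fourier_coe]
    have := congrFun (VectorFourier.fourierIntegral_comp_add_right Real.fourierChar
      (volume : Measure (Rn n)) (innerₗ (Rn n)) φ h) ξ
    rw [Circle.smul_def] at this
    have h5 : (⇑(SchwartzMap.compSubConstCLM ℂ (-h) φ) : Rn n → ℂ) = φ ∘ fun v => v + h := by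
      ext x; simp
    rw [h5]
    exact this

theorem lintegral_enorm_sq_eq {n : ℕ} {E : Type*} [NormedAddCommGroup E]
    (v : Lp E 2 (volume : Measure (Rn n))) : ∫⁻ x, ‖v x‖ₑ ^ 2 = ‖v‖ₑ ^ 2 := by
  rw [Lp.enorm_def, eLpNorm_eq_lintegral_rpow_enorm_toReal (by norm_num) (by norm_num)]
  simp only [ENNReal.toReal_ofNat, ENNReal.rpow_ofNat]
  rw [← ENNReal.rpow_natCast, ← ENNReal.rpow_mul]
  norm_num

/-- Plancherel: u(· + h) - u has Fourier transform (e^{2πi h·ξ} - 1) 𝓕u. -/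
theorem lintegral_shift_sub {n : ℕ} (h : Rn n) (u : L2 n) :
    ∫⁻ x, ‖u (x + h) - u x‖ₑ ^ 2 =
      ∫⁻ ξ, ‖((Real.fourierChar (inner ℝ h ξ) : Circle) : ℂ) - 1‖ₑ ^ 2 * ‖fourierL2 u ξ‖ₑ ^ 2 := by
  set U : Lp ℂ 2 (volume : Measure (Rn n)) := Complex.ofRealCLM.compLp u
  have hU : U =ᵐ[volume] fun x => (u x : ℂ) := Complex.ofRealCLM.coeFn_compLp u
  have h1 : ∫⁻ x, ‖u (x + h) - u x‖ₑ ^ 2 = ∫⁻ x, ‖(shift h U - U : Lp ℂ 2 volume) x‖ₑ ^ 2 := by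
    apply lintegral_congr_ae
    filter_upwards [hU, (measurePreserving_add_right (volume : Measure (Rn n)) h).quasiMeasurePreserving.ae_eq_comp hU,
      coeFn_shift h U, Lp.coeFn_sub (shift h U) U] with x h1 h2 h3 h4
    simp only [Function.comp_apply] at h2
    rw [h4, Pi.sub_apply, h3, h1, h2, ← Complex.ofReal_sub]
    rw [← ofReal_norm, ← ofReal_norm, Complex.norm_real]
  rw [h1, lintegral_enorm_sq_eq, ← (Lp.fourierTransformₗᵢ (Rn n) ℂ).enorm_map, map_sub]
  change ‖𝓕 (shift h U) - 𝓕 U‖ₑ ^ 2 = _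
  rw [fourier_shift, ← lintegral_enorm_sq_eq]
  apply lintegral_congr_ae
  filter_upwards [coeFn_phaseMul h (𝓕 U), Lp.coeFn_sub (phaseMul h (𝓕 U)) (𝓕 U)] with ξ h2 h3
  rw [h3, Pi.sub_apply, h2, ← mul_pow, ← enorm_mul, sub_mul, one_mul]
  rfl

/-! ### The Gagliardo form of the energy -/

/-- The kernel `|h|^{-n-2s}`. -/
def kernel {n : ℕ} (s : ℝ) (h : Rn n) : ℝ≥0∞ := ENNReal.ofReal (‖h‖ ^ (-(n + 2 * s)))

/-- The squared modulus of `e^{2πi h·ξ} - 1`. -/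
def phaseDiff {n : ℕ} (h ξ : Rn n) : ℝ≥0∞ :=
  ‖((Real.fourierChar (inner ℝ h ξ) : Circle) : ℂ) - 1‖ₑ ^ 2

theorem measurable_kernel {n : ℕ} (s : ℝ) : Measurable (kernel s : Rn n → ℝ≥0∞) := by
  unfold kernel; fun_prop

theorem measurable_phaseDiff {n : ℕ} :
    Measurable (fun p : Rn n × Rn n => phaseDiff p.1 p.2) := by
  have : Continuous (fun p : Rn n × Rn n => ((Real.fourierChar (inner ℝ p.1 p.2) : Circle) : ℂ) - 1) := by
    fun_prop
  unfold phaseDiff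
  exact this.measurable.enorm.pow_const 2

theorem measurable_phaseDiff_left {n : ℕ} (ξ : Rn n) : Measurable fun h : Rn n => phaseDiff h ξ := by
  have : Continuous (fun h : Rn n => ((Real.fourierChar (inner ℝ h ξ) : Circle) : ℂ) - 1) := by
    fun_prop
  unfold phaseDiff
  exact this.measurable.enorm.pow_const 2

theorem phaseDiff_le {n : ℕ} (h ξ : Rn n) :
    phaseDiff h ξ ≤ ENNReal.ofReal ((2 * Real.pi * ‖ξ‖) ^ 2 * ‖h‖ ^ 2) := by
  have h1 : ‖((Real.fourierChar (inner ℝ h ξ) : Circle) : ℂ) - 1‖ ≤ 2 * Real.pi * ‖ξ‖ * ‖h‖ := by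
    have := Real.norm_exp_I_mul_ofReal_sub_one_le (x := 2 * Real.pi * inner ℝ h ξ)
    rw [Real.fourierChar_apply, mul_comm _ Complex.I]
    refine this.trans ?_
    rw [norm_mul, Real.norm_of_nonneg (by positivity), mul_assoc (2 * Real.pi)]
    gcongr
    rw [mul_comm]
    exact norm_inner_le_norm h ξ
  unfold phaseDiff
  rw [← ofReal_norm, ← ENNReal.ofReal_pow (norm_nonneg _), ← mul_pow]
  gcongr

theorem phaseDiff_le_four {n : ℕ} (h ξ : Rn n) : phaseDiff h ξ ≤ 4 := by
  have h1 : ‖((Real.fourierChar (inner ℝ h ξ) : Circle) : ℂ) - 1‖ ≤ 2 := by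
    refine (norm_sub_le _ _).trans ?_
    rw [Circle.norm_coe]; norm_num
  unfold phaseDiff
  rw [← ofReal_norm, ← ENNReal.ofReal_pow (norm_nonneg _)]
  refine ENNReal.ofReal_le_of_le_toReal ?_
  norm_num
  nlinarith [norm_nonneg (((Real.fourierChar (inner ℝ h ξ) : Circle) : ℂ) - 1)]

/-- Near 0 the phase difference is O(|h|²) and |h|^{2-n-2s} is integrable because s < 1; away from 0
it is at most 4 and the kernel is integrable because s > 0. -/
theorem lintegral_kernel_phaseDiff_lt_top {n : ℕ} (hn : 1 ≤ n) {s : ℝ} (hs0 : 0 < s) (hs1 : s < 1)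
    (ξ : Rn n) : ∫⁻ h, kernel s h * phaseDiff h ξ < ∞ := by
  rw [← lintegral_add_compl _ (measurableSet_ball (x := (0 : Rn n)) (ε := 1))]
  refine ENNReal.add_lt_top.2 ⟨?_, ?_⟩
  · have hint : IntegrableOn (fun h : Rn n => (2 * Real.pi * ‖ξ‖) ^ 2 * ‖h‖ ^ (-(n + 2 * s - 2)))
        (Metric.ball 0 1) := by
      refine integrableOn_ball_of_norm_le_rpow (by simpa using hn) (C := (2 * Real.pi * ‖ξ‖) ^ 2)
        (α := n + 2 * s - 2) (by simp; linarith) (Filter.Eventually.of_forall fun h => ?_) ?_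
      · rw [Real.norm_of_nonneg (by positivity)]
      · exact (by fun_prop : Measurable _).aestronglyMeasurable
    refine lt_of_le_of_lt (lintegral_mono fun h => ?_) hint.lintegral_lt_top
    rcases eq_or_ne h 0 with rfl | hh
    · simp [phaseDiff]
    refine (mul_le_mul_right (phaseDiff_le h ξ) _).trans ?_
    rw [kernel, ← ENNReal.ofReal_mul (by positivity)]
    apply ENNReal.ofReal_le_ofReal
    have h0 : 0 < ‖h‖ := norm_pos_iff.2 hh
    have : ‖h‖ ^ (-(n + 2 * s - 2)) = ‖h‖ ^ (-(n + 2 * s)) * ‖h‖ ^ 2 := by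
      rw [← Real.rpow_natCast, ← Real.rpow_add h0]; congr 1; push_cast; ring
    rw [this]
    exact le_of_eq (by ring)
  · have hint : Integrable (fun h : Rn n => 2 ^ (n + 2 * s) * (1 + ‖h‖) ^ (-(n + 2 * s))) :=
      (integrable_one_add_norm (by simp; linarith)).const_mul _
    have h4 : ∫⁻ h in (Metric.ball (0 : Rn n) 1)ᶜ, kernel s h * phaseDiff h ξ
        ≤ ∫⁻ h : Rn n, ENNReal.ofReal (2 ^ (n + 2 * s) * (1 + ‖h‖) ^ (-(n + 2 * s))) * 4 := by
      refine (setLIntegral_mono' measurableSet_ball.compl fun h hh => ?_).trans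
        (setLIntegral_le_lintegral _ _)
      refine mul_le_mul' ?_ (phaseDiff_le_four h ξ)
      apply ENNReal.ofReal_le_ofReal
      have h1 : 1 ≤ ‖h‖ := by simpa using hh
      rw [Real.rpow_neg (by positivity), Real.rpow_neg (by positivity), ← div_eq_mul_inv,
        ← one_div, div_le_div_iff₀ (by positivity) (by positivity), one_mul,
        ← Real.mul_rpow (by positivity) (by positivity)]
      exact Real.rpow_le_rpow (by positivity) (by linarith) (by positivity)
    refine h4.trans_lt ?_
    rw [lintegral_mul_const' _ _ (by norm_num)]
    exact ENNReal.mul_lt_top hint.lintegral_lt_top (by norm_num)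

theorem lintegral_kernel_phaseDiff_map {n : ℕ} (s : ℝ) (ξ : Rn n) (R : Rn n ≃ₗᵢ[ℝ] Rn n) :
    ∫⁻ h, kernel s h * phaseDiff h (R ξ) = ∫⁻ h, kernel s h * phaseDiff h ξ := by
  rw [← R.measurePreserving.lintegral_comp_emb R.toHomeomorph.measurableEmbedding]
  simp [kernel, phaseDiff]

theorem lintegral_comp_smul_pos {n : ℕ} (g : Rn n → ℝ≥0∞) {t : ℝ} (ht : 0 < t) :
    ∫⁻ h, g (t • h) = ENNReal.ofReal (t ^ (-(n : ℝ))) * ∫⁻ h, g h := by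
  have h1 := (Homeomorph.smulOfNeZero t ht.ne' (α := Rn n)).measurableEmbedding.lintegral_map
    (μ := volume) g
  have h2 : ⇑(Homeomorph.smulOfNeZero t ht.ne' (α := Rn n)) = (t • ·) := rfl
  rw [h2, Measure.map_addHaar_smul _ ht.ne', lintegral_smul_measure] at h1
  rw [← h1, smul_eq_mul]
  congr 2
  rw [Real.rpow_neg ht.le, Real.rpow_natCast, abs_of_nonneg (by positivity)]
  simp

theorem lintegral_kernel_phaseDiff_smul {n : ℕ} (s : ℝ) (ξ : Rn n) {t : ℝ} (ht : 0 < t) :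
    ∫⁻ h, kernel s h * phaseDiff h (t • ξ) =
      ENNReal.ofReal (t ^ (2 * s)) * ∫⁻ h, kernel s h * phaseDiff h ξ := by
  have h1 : ∀ h : Rn n, kernel s h * phaseDiff h (t • ξ) =
      ENNReal.ofReal (t ^ (n + 2 * s)) * (kernel s (t • h) * phaseDiff (t • h) ξ) := by
    intro h
    have h2 : phaseDiff h (t • ξ) = phaseDiff (t • h) ξ := by
      simp [phaseDiff, inner_smul_left, inner_smul_right]
    rw [h2, ← mul_assoc]
    congr 1
    rw [kernel, kernel, ← ENNReal.ofReal_mul (by positivity), norm_smul,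
      Real.norm_of_nonneg ht.le, Real.mul_rpow ht.le (norm_nonneg _), ← mul_assoc,
      ← Real.rpow_add ht]
    simp
  simp_rw [h1]
  rw [lintegral_const_mul' _ _ ENNReal.ofReal_ne_top,
    lintegral_comp_smul_pos (fun h => kernel s h * phaseDiff h ξ) ht, ← mul_assoc,
    ← ENNReal.ofReal_mul (by positivity), ← Real.rpow_add ht]
  congr 3; ring

/-- At h = ξ/2 the phase is e^{iπ} = -1, so the integrand is positive on a nonempty open set. -/
theorem lintegral_kernel_phaseDiff_ne_zero {n : ℕ} (s : ℝ) {ξ : Rn n} (hξ : ‖ξ‖ = 1) :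
    ∫⁻ h, kernel s h * phaseDiff h ξ ≠ 0 := by
  intro h0
  have hm : Measurable fun h : Rn n => kernel s h * phaseDiff h ξ :=
    (measurable_kernel s).mul (measurable_phaseDiff_left ξ)
  rw [lintegral_eq_zero_iff hm] at h0
  have hc : Continuous fun h : Rn n => ((Real.fourierChar (inner ℝ h ξ) : Circle) : ℂ) - 1 := by fun_prop
  have hopen : IsOpen {h : Rn n | h ≠ 0 ∧ ((Real.fourierChar (inner ℝ h ξ) : Circle) : ℂ) - 1 ≠ 0} :=
    isOpen_ne.inter (isOpen_ne.preimage hc)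
  have hne : {h : Rn n | h ≠ 0 ∧ ((Real.fourierChar (inner ℝ h ξ) : Circle) : ℂ) - 1 ≠ 0}.Nonempty := by
    refine ⟨(1 / 2 : ℝ) • ξ, ?_, ?_⟩
    · have : ξ ≠ 0 := by rintro rfl; simp at hξ
      simpa using this
    · rw [Real.fourierChar_apply, inner_smul_left, real_inner_self_eq_norm_sq, hξ]
      have : ((2 * Real.pi * ((starRingEnd ℝ) (1 / 2) * 1 ^ 2) : ℝ) : ℂ) * Complex.I
          = Real.pi * Complex.I := by
        simp; ring
      rw [this, Complex.exp_pi_mul_I]; norm_num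
  refine (hopen.measure_pos volume hne).ne' (measure_mono_null ?_ h0)
  rintro h ⟨h1, h2⟩ h3
  simp only [Pi.zero_apply, mul_eq_zero, kernel, phaseDiff, ENNReal.ofReal_eq_zero,
    pow_eq_zero_iff two_ne_zero, enorm_eq_zero] at h3
  rcases h3 with h3 | h3
  · exact h3.not_gt (Real.rpow_pos_of_pos (norm_pos_iff.2 h1) _)
  · exact h2 h3

/-- In ξ the integral is rotation invariant and homogeneous of degree 2s, hence determined by its
value at one unit vector; κ is that value divided by (2π)^{2s}. -/
theorem exists_kernel_const {n : ℕ} (hn : 1 ≤ n) {s : ℝ} (hs0 : 0 < s) (hs1 : s < 1) :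
    ∃ κ : ℝ≥0∞, κ ≠ 0 ∧ κ ≠ ∞ ∧
      ∀ ξ : Rn n, ∫⁻ h, kernel s h * phaseDiff h ξ = κ * ENNReal.ofReal (symbol s ξ) := by
  have : Nonempty (Fin n) := ⟨⟨0, hn⟩⟩
  obtain ⟨e, he⟩ := exists_norm_eq (Rn n) zero_le_one
  have hpi : (0 : ℝ) < (2 * Real.pi) ^ (-(2 * s)) := by positivity
  refine ⟨ENNReal.ofReal ((2 * Real.pi) ^ (-(2 * s))) * ∫⁻ h, kernel s h * phaseDiff h e,
    mul_ne_zero (by simpa using hpi) (lintegral_kernel_phaseDiff_ne_zero s he),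
    ENNReal.mul_ne_top ENNReal.ofReal_ne_top (lintegral_kernel_phaseDiff_lt_top hn hs0 hs1 e).ne,
    fun ξ => ?_⟩
  rcases eq_or_ne ξ 0 with rfl | hξ
  · have : (2 * s) ≠ 0 := by positivity
    simp [phaseDiff, symbol, Real.zero_rpow this]
  have hξ' : 0 < ‖ξ‖ := norm_pos_iff.2 hξ
  have h1 : ‖‖ξ‖ • e‖ = ‖ξ‖ := by rw [norm_smul, he]; simp
  -- The reflection in the hyperplane orthogonal to ‖ξ‖e - ξ carries ‖ξ‖e to ξ.
  have h2 := lintegral_kernel_phaseDiff_map s (‖ξ‖ • e) (Submodule.reflection (Submodule.span ℝ {‖ξ‖ • e - ξ})ᗮ)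
  rw [Submodule.reflection_sub h1, lintegral_kernel_phaseDiff_smul s e hξ'] at h2
  rw [h2, mul_right_comm, ← ENNReal.ofReal_mul hpi.le, symbol, Real.mul_rpow (by positivity) hξ'.le,
    ← mul_assoc, ← Real.rpow_add (by positivity)]
  simp

/-- The Gagliardo energy `∬ |u(x+h) - u(x)|² |h|^{-n-2s} dx dh`. -/
def gagliardo {n : ℕ} (s : ℝ) (u : L2 n) : ℝ≥0∞ :=
  ∫⁻ h, kernel s h * ∫⁻ x, ‖u (x + h) - u x‖ₑ ^ 2

/-- The energy `∫ |2πξ|^{2s} |𝓕 u(ξ)|² dξ`. -/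
def energy {n : ℕ} (s : ℝ) (u : L2 n) : ℝ≥0∞ :=
  ∫⁻ ξ, ENNReal.ofReal (symbol s ξ) * ‖fourierL2 u ξ‖ₑ ^ 2

theorem exists_gagliardo_eq {n : ℕ} (hn : 1 ≤ n) {s : ℝ} (hs0 : 0 < s) (hs1 : s < 1) :
    ∃ κ : ℝ≥0∞, κ ≠ 0 ∧ κ ≠ ∞ ∧ ∀ u : L2 n, gagliardo s u = κ * energy s u := by
  obtain ⟨κ, h0, ht, hκ⟩ := exists_kernel_const hn hs0 hs1
  refine ⟨κ, h0, ht, fun u => ?_⟩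
  have hu : Measurable fun ξ => ‖fourierL2 u ξ‖ₑ ^ 2 :=
    (Lp.stronglyMeasurable (fourierL2 u)).measurable.enorm.pow_const 2
  have h1 : ∀ h : Rn n, kernel s h * ∫⁻ x, ‖u (x + h) - u x‖ₑ ^ 2 =
      ∫⁻ ξ, kernel s h * (phaseDiff h ξ * ‖fourierL2 u ξ‖ₑ ^ 2) := by
    intro h
    rw [lintegral_shift_sub, lintegral_const_mul' _ _ (by simp [kernel])]
    rfl
  unfold gagliardo energy
  simp_rw [h1]
  rw [lintegral_lintegral_swap, ← lintegral_const_mul' _ _ ht]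
  · refine lintegral_congr fun ξ => ?_
    simp_rw [← mul_assoc]
    rw [lintegral_mul_const' _ _ (by simp), hκ]
  · refine Measurable.aemeasurable ?_
    exact ((measurable_kernel s).comp measurable_fst).mul
      (measurable_phaseDiff.mul (hu.comp measurable_snd))

/-! ### Lipschitz truncation and the Faber–Krahn inequality -/

/-- Composition with a Lipschitz function decreases the energy. -/
theorem energy_compLp_le {n : ℕ} (hn : 1 ≤ n) {s : ℝ} (hs0 : 0 < s) (hs1 : s < 1)
    {F : ℝ → ℝ} (hF : LipschitzWith 1 F) (hF0 : F 0 = 0) (u : L2 n) :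
    energy s (hF.compLp hF0 u) ≤ energy s u := by
  obtain ⟨κ, h0, ht, hκ⟩ := exists_gagliardo_eq hn hs0 hs1
  -- After multiplication by κ both sides are Gagliardo integrals, and the inequality holds
  -- pointwise in the integrand.
  rw [← ENNReal.mul_le_mul_iff_right h0 ht, ← hκ, ← hκ]
  refine lintegral_mono fun h => mul_le_mul_right (lintegral_mono_ae ?_) _
  have hU := hF.coeFn_compLp hF0 u
  filter_upwards [hU, (measurePreserving_add_right (volume : Measure (Rn n)) h).quasiMeasurePreserving.ae_eq_comp hU]
    with x h1 h2
  simp only [Function.comp_apply] at h2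
  rw [h1, h2]
  gcongr
  simpa [edist_eq_enorm_sub] using hF (u (x + h)) (u x)

/-- Faber–Krahn inequality. -/
theorem exists_faberKrahn {n : ℕ} (hn : 1 ≤ n) {s : ℝ} (hs0 : 0 < s) (hs1 : s < 1) :
    ∃ C : ℝ, 0 ≤ C ∧ ∀ (u : L2 n) (m : ℝ), 0 < m → volume {x | u x ≠ 0} ≤ ENNReal.ofReal m →
      ‖u‖ₑ ^ 2 ≤ ENNReal.ofReal (C * m ^ (2 * s / n)) * energy s u := by
  obtain ⟨κ, h0, ht, hκ⟩ := exists_gagliardo_eq hn hs0 hs1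
  have : Nonempty (Fin n) := ⟨⟨0, hn⟩⟩
  have hn' : (0 : ℝ) < n := by exact_mod_cast hn
  set b : ℝ := volume.real (Metric.ball (0 : Rn n) 1)
  have hb : 0 < b := ENNReal.toReal_pos (Metric.measure_ball_pos _ _ one_pos).ne' measure_ball_lt_top.ne
  have hvol : ∀ r : ℝ, 0 ≤ r → volume (Metric.ball (0 : Rn n) r) = ENNReal.ofReal (r ^ n * b) := by
    intro r hr
    rw [Measure.addHaar_ball _ _ hr, ENNReal.ofReal_mul (by positivity), finrank_euclideanSpace_fin,
      ofReal_measureReal measure_ball_lt_top.ne]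
  -- With r^n = 2m/b, the quotient κ / (r^{-(n+2s)} m) is this constant times m^{2s/n}.
  refine ⟨κ.toReal * (2 / b) ^ ((n + 2 * s) / n), by positivity, fun u m hm hA => ?_⟩
  -- radius of the ball of volume `2m`
  set r : ℝ := (2 * m / b) ^ (1 / (n : ℝ)) with hr
  have hr0 : 0 < r := by positivity
  have hrn : r ^ n * b = 2 * m := by
    rw [hr, ← Real.rpow_natCast, ← Real.rpow_mul (by positivity)]
    rw [one_div_mul_cancel hn'.ne', Real.rpow_one, div_mul_cancel₀ _ hb.ne']
  set A : Set (Rn n) := {x | u x ≠ 0}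
  have hAm : MeasurableSet A :=
    (Lp.stronglyMeasurable u).measurable (measurableSet_singleton (0 : ℝ)).compl
  -- lower bound for the kernel outside the support
  have key : ∀ x : Rn n, ENNReal.ofReal (r ^ (-(n + 2 * s)) * m) ≤
      ∫⁻ h, kernel s h * ({h | x + h ∉ A}.indicator 1 h) := by
    intro x
    have hS : MeasurableSet {h : Rn n | x + h ∉ A} := (measurable_const_add x) hAm.compl
    have hSc : volume ((x + ·) ⁻¹' A) ≤ ENNReal.ofReal m := by
      rwa [measure_preimage_add]
    -- A ball of volume 2m loses at most m to a translate of `A`. The origin is removed because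
    -- `kernel s 0` is 0, a default value of the real power, and would violate the lower bound.
    have h1 : ENNReal.ofReal m ≤ volume ((Metric.ball (0 : Rn n) r \ {0}) ∩ {h | x + h ∉ A}) := by
      have h2 : volume (Metric.ball (0 : Rn n) r) ≤
          volume ((Metric.ball (0 : Rn n) r \ {0}) ∩ {h | x + h ∉ A}) + volume ((x + ·) ⁻¹' A)
            + volume {(0 : Rn n)} := by
        refine (measure_mono ?_).trans ((measure_union_le _ _).trans (add_le_add (measure_union_le _ _) le_rfl))
        intro h hh
        by_cases h3 : x + h ∈ A
        · exact Or.inl (Or.inr h3)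
        · by_cases h4 : h = 0
          · exact Or.inr h4
          · exact Or.inl (Or.inl ⟨⟨hh, h4⟩, h3⟩)
      have h0' : volume {(0 : Rn n)} = 0 := by
        have : Nontrivial (Rn n) := inferInstance
        simp
      rw [h0', add_zero, hvol r hr0.le, hrn, two_mul, ENNReal.ofReal_add hm.le hm.le] at h2
      exact (ENNReal.add_le_add_iff_right ENNReal.ofReal_ne_top).1 (h2.trans (add_le_add le_rfl hSc))
    calc ENNReal.ofReal (r ^ (-(n + 2 * s)) * m)
        = ENNReal.ofReal (r ^ (-(n + 2 * s))) * ENNReal.ofReal m :=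
          ENNReal.ofReal_mul (by positivity)
      _ ≤ ENNReal.ofReal (r ^ (-(n + 2 * s))) *
          volume ((Metric.ball (0 : Rn n) r \ {0}) ∩ {h | x + h ∉ A}) := mul_le_mul_right h1 _
      _ = ∫⁻ h in (Metric.ball (0 : Rn n) r \ {0}) ∩ {h | x + h ∉ A},
          ENNReal.ofReal (r ^ (-(n + 2 * s))) := by rw [setLIntegral_const]
      _ ≤ ∫⁻ h in (Metric.ball (0 : Rn n) r \ {0}) ∩ {h | x + h ∉ A},
          kernel s h * ({h | x + h ∉ A}.indicator 1 h) := by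
        refine setLIntegral_mono' ((measurableSet_ball.diff (measurableSet_singleton _)).inter hS) ?_
        rintro h ⟨⟨h2, h3⟩, h4⟩
        rw [Set.indicator_of_mem h4, Pi.one_apply, mul_one]
        apply ENNReal.ofReal_le_ofReal
        refine Real.rpow_le_rpow_of_nonpos (norm_pos_iff.2 h3) ?_ (by linarith)
        simpa using (mem_ball_zero_iff.1 h2).le
      _ ≤ _ := setLIntegral_le_lintegral _ _
  have hum : Measurable fun x => ‖u x‖ₑ ^ 2 :=
    (Lp.stronglyMeasurable u).measurable.enorm.pow_const 2
  have hmeas : Measurable fun p : Rn n × Rn n => {h | p.2 + h ∉ A}.indicator (1 : Rn n → ℝ≥0∞) p.1 := by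
    have : (fun p : Rn n × Rn n => {h | p.2 + h ∉ A}.indicator (1 : Rn n → ℝ≥0∞) p.1)
        = {p : Rn n × Rn n | p.2 + p.1 ∉ A}.indicator 1 := by
      ext p; simp [Set.indicator]
    rw [this]
    exact measurable_one.indicator ((by fun_prop : Measurable fun p : Rn n × Rn n => p.2 + p.1) hAm.compl)
  have h3 : ENNReal.ofReal (r ^ (-(n + 2 * s)) * m) * ‖u‖ₑ ^ 2 ≤ gagliardo s u := by
    rw [← lintegral_enorm_sq_eq, ← lintegral_const_mul' _ _ ENNReal.ofReal_ne_top]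
    calc ∫⁻ x, ENNReal.ofReal (r ^ (-(n + 2 * s)) * m) * ‖u x‖ₑ ^ 2
        ≤ ∫⁻ x, ∫⁻ h, kernel s h * ({h | x + h ∉ A}.indicator 1 h) * ‖u x‖ₑ ^ 2 := by
          refine lintegral_mono fun x => ?_
          rw [lintegral_mul_const' _ _ (by simp)]
          exact mul_le_mul_left (key x) _
      _ = ∫⁻ h, ∫⁻ x, kernel s h * ({h | x + h ∉ A}.indicator 1 h) * ‖u x‖ₑ ^ 2 := by
          rw [lintegral_lintegral_swap]
          refine Measurable.aemeasurable ?_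
          have h5 := hmeas.comp measurable_swap
          exact (((measurable_kernel s).comp measurable_snd).mul h5).mul (hum.comp measurable_fst)
      _ ≤ gagliardo s u := by
          refine lintegral_mono fun h => ?_
          simp_rw [mul_assoc]
          rw [lintegral_const_mul' _ _ (by simp [kernel])]
          refine mul_le_mul_right (lintegral_mono fun x => ?_) _
          -- Off the support u(x + h) = 0, so the difference quotient there is exactly |u(x)|².
          by_cases hx : x + h ∈ A
          · simp [hx]
          · have : u (x + h) = 0 := by simpa [A] using hx
            simp [hx, this]
  have hc : 0 < r ^ (-(n + 2 * s)) * m := by positivity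
  have h6 : κ.toReal * (2 / b) ^ ((n + 2 * s) / n) * m ^ (2 * s / n)
      = κ.toReal * (r ^ (-(n + 2 * s)) * m)⁻¹ := by
    rw [mul_assoc κ.toReal, mul_inv, Real.rpow_neg hr0.le, inv_inv, hr, ← Real.rpow_mul (by positivity),
      show (2 : ℝ) * m / b = 2 / b * m by ring, Real.mul_rpow (by positivity) hm.le, mul_assoc, ← Real.rpow_neg_one m,
      ← Real.rpow_add hm]
    congr 3
    · ring
    · field_simp
      ring
  rw [hκ] at h3
  rw [h6, ENNReal.ofReal_mul (by positivity), ENNReal.ofReal_toReal ht, ENNReal.ofReal_inv_of_pos hc,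
    mul_right_comm, ← div_eq_mul_inv]
  rw [ENNReal.le_div_iff_mul_le (Or.inl (by simpa using hc)) (Or.inl ENNReal.ofReal_ne_top), mul_comm]
  exact h3

/-! ### The energy space as a Hilbert space -/

/-- The Fourier transform of real-valued functions as a continuous real-linear map. -/
def fourierCLM {n : ℕ} : L2 n →L[ℝ] Lp ℂ 2 (volume : Measure (Rn n)) :=
  ((Lp.fourierTransformₗᵢ (Rn n) ℂ).toContinuousLinearEquiv.toContinuousLinearMap.restrictScalars ℝ).comp
    (Complex.ofRealCLM.compLpL 2 volume)

theorem fourierCLM_apply {n : ℕ} (u : L2 n) : fourierCLM u = fourierL2 u := rfl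

theorem fourierL2_add {n : ℕ} (u v : L2 n) : fourierL2 (u + v) = fourierL2 u + fourierL2 v :=
  map_add fourierCLM u v

theorem fourierL2_smul {n : ℕ} (c : ℝ) (u : L2 n) : fourierL2 (c • u) = c • fourierL2 u :=
  map_smul fourierCLM c u

theorem symbol_nonneg {n : ℕ} (s : ℝ) (ξ : Rn n) : 0 ≤ symbol s ξ := by
  unfold symbol; positivity

theorem symbol_half_sq {n : ℕ} (s : ℝ) (ξ : Rn n) : symbol (s / 2) ξ ^ 2 = symbol s ξ := by
  rw [symbol, symbol, ← Real.rpow_natCast, ← Real.rpow_mul (by positivity)]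
  congr 1; push_cast; ring

theorem measurable_symbol {n : ℕ} (s : ℝ) : Measurable (symbol s : Rn n → ℝ) := by
  unfold symbol; fun_prop

theorem aestronglyMeasurable_symbol_mul {n : ℕ} (s : ℝ) (v : Lp ℂ 2 (volume : Measure (Rn n))) :
    AEStronglyMeasurable (fun ξ => (symbol s ξ : ℂ) * v ξ) volume :=
  (Complex.measurable_ofReal.comp (measurable_symbol s)).aestronglyMeasurable.mul
    (Lp.aestronglyMeasurable v)

theorem enorm_symbol_half_mul_sq {n : ℕ} (s : ℝ) (ξ : Rn n) (z : ℂ) :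
    ‖(symbol (s / 2) ξ : ℂ) * z‖ₑ ^ 2 = ENNReal.ofReal (symbol s ξ) * ‖z‖ₑ ^ 2 := by
  rw [enorm_mul, mul_pow, ← ofReal_norm, Complex.norm_real, ← ENNReal.ofReal_pow (norm_nonneg _),
    Real.norm_of_nonneg (symbol_nonneg _ _), symbol_half_sq]

theorem memHs_iff {n : ℕ} {s : ℝ} {u : L2 n} : MemHs s u ↔ energy s u < ∞ := by
  have h : eLpNorm (fun ξ : Rn n => (symbol (s / 2) ξ : ℂ) * fourierL2 u ξ) 2 volume
      = energy s u ^ (1 / 2 : ℝ) := by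
    rw [eLpNorm_eq_lintegral_rpow_enorm_toReal (by norm_num) (by norm_num)]
    simp only [ENNReal.toReal_ofNat, ENNReal.rpow_ofNat, enorm_symbol_half_mul_sq]
    rfl
  rw [MemHs, MemLp, h, ENNReal.rpow_lt_top_iff_of_pos (by norm_num)]
  exact and_iff_right (aestronglyMeasurable_symbol_mul _ _)

/-- `H̃ˢ(Ω)` as a linear subspace of `L²`. -/
def hsTildeSubmodule {n : ℕ} (s : ℝ) (Ω : Set (Rn n)) : Submodule ℝ (L2 n) where
  carrier := HsTilde s Ω
  zero_mem' := by
    refine ⟨?_, ?_⟩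
    · rw [memHs_iff, energy, ← fourierCLM_apply, map_zero]
      have : ∫⁻ ξ : Rn n, ENNReal.ofReal (symbol s ξ) *
          ‖(0 : Lp ℂ 2 (volume : Measure (Rn n))) ξ‖ₑ ^ 2 = ∫⁻ ξ : Rn n, 0 := by
        apply lintegral_congr_ae
        filter_upwards [Lp.coeFn_zero ℂ 2 (volume : Measure (Rn n))] with ξ h
        rw [h, Pi.zero_apply, enorm_zero, zero_pow two_ne_zero, mul_zero]
      rw [this, lintegral_zero]
      exact ENNReal.zero_lt_top
    · filter_upwards [Lp.coeFn_zero ℝ 2 (volume : Measure (Rn n))] with x h _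
      rw [h, Pi.zero_apply]
  add_mem' := by
    rintro u v ⟨hu, hu'⟩ ⟨hv, hv'⟩
    refine ⟨?_, ?_⟩
    · refine (hu.add hv).ae_eq ?_
      filter_upwards [Lp.coeFn_add (fourierL2 u) (fourierL2 v)] with ξ h
      rw [fourierL2_add, h]
      simp [mul_add]
    · filter_upwards [Lp.coeFn_add u v, hu', hv'] with x h h1 h2 hx
      rw [h, Pi.add_apply, h1 hx, h2 hx, add_zero]
  smul_mem' := by
    rintro c u ⟨hu, hu'⟩
    refine ⟨?_, ?_⟩
    · refine (hu.const_smul c).ae_eq ?_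
      filter_upwards [Lp.coeFn_smul c (fourierL2 u)] with ξ h
      rw [fourierL2_smul, h]
      simp [mul_left_comm]
    · filter_upwards [Lp.coeFn_smul c u, hu'] with x h h1 hx
      rw [h, Pi.smul_apply, h1 hx, smul_zero]

theorem memHs_coe {n : ℕ} {s : ℝ} {Ω : Set (Rn n)} (u : hsTildeSubmodule s Ω) :
    MemLp (fun ξ : Rn n => (symbol (s / 2) ξ : ℂ) * fourierL2 (u : L2 n) ξ) 2 volume :=
  u.2.1

/-- The Fourier transform of `(-Δ)^{s/2} u`, for `u ∈ H̃ˢ(Ω)`. -/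
def halfLaplacian {n : ℕ} (s : ℝ) (Ω : Set (Rn n)) :
    hsTildeSubmodule s Ω →ₗ[ℝ] Lp ℂ 2 (volume : Measure (Rn n)) where
  toFun u := (memHs_coe u).toLp
  map_add' u v := by
    rw [← MemLp.toLp_add (memHs_coe u) (memHs_coe v)]
    apply MemLp.toLp_congr
    filter_upwards [Lp.coeFn_add (fourierL2 (u : L2 n)) (fourierL2 (v : L2 n))] with ξ h
    rw [Submodule.coe_add, fourierL2_add, h]
    simp [mul_add]
  map_smul' c u := by
    rw [RingHom.id_apply, ← MemLp.toLp_const_smul c (memHs_coe u)]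
    apply MemLp.toLp_congr
    filter_upwards [Lp.coeFn_smul c (fourierL2 (u : L2 n))] with ξ h
    rw [Submodule.coe_smul, fourierL2_smul, h]
    simp [mul_left_comm]

theorem coeFn_halfLaplacian {n : ℕ} (s : ℝ) (Ω : Set (Rn n)) (u : hsTildeSubmodule s Ω) :
    halfLaplacian s Ω u =ᵐ[volume] fun ξ => (symbol (s / 2) ξ : ℂ) * fourierL2 (u : L2 n) ξ :=
  (memHs_coe u).coeFn_toLp

/-- Moves all geometry of the form into L². The real inner product on complex L² is the real part of
the complex one, matching the real part in `fracForm`. -/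
theorem inner_halfLaplacian {n : ℕ} (s : ℝ) (Ω : Set (Rn n)) (u v : hsTildeSubmodule s Ω) :
    inner ℝ (halfLaplacian s Ω u) (halfLaplacian s Ω v) = fracForm s (u : L2 n) v := by
  have h1 := L2.integrable_inner (𝕜 := ℂ) (halfLaplacian s Ω v) (halfLaplacian s Ω u)
  have h2 : (fun ξ => inner ℂ (halfLaplacian s Ω v ξ) (halfLaplacian s Ω u ξ)) =ᵐ[volume]
      fun ξ => (symbol s ξ : ℂ) * (fourierL2 (u : L2 n) ξ *
        (starRingEnd ℂ) (fourierL2 (v : L2 n) ξ)) := by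
    filter_upwards [coeFn_halfLaplacian s Ω u, coeFn_halfLaplacian s Ω v] with ξ h3 h4
    rw [h3, h4, ← symbol_half_sq s ξ]
    simp only [RCLike.inner_apply, map_mul, Complex.conj_ofReal, Complex.ofReal_pow]
    ring
  rw [fracForm, ← integral_congr_ae h2, ← Complex.reCLM_apply, ← Complex.reCLM.integral_comp_comm h1,
    L2.inner_def]
  refine integral_congr_ae (Eventually.of_forall fun ξ => ?_)
  simp only [Complex.inner, Complex.reCLM_apply, RCLike.inner_apply, Complex.mul_re, Complex.conj_re,
    Complex.conj_im]
  ring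

theorem enorm_halfLaplacian_sq {n : ℕ} (s : ℝ) (Ω : Set (Rn n)) (u : hsTildeSubmodule s Ω) :
    ‖halfLaplacian s Ω u‖ₑ ^ 2 = energy s (u : L2 n) := by
  rw [← lintegral_enorm_sq_eq]
  refine lintegral_congr_ae ?_
  filter_upwards [coeFn_halfLaplacian s Ω u] with ξ h
  rw [h, enorm_symbol_half_mul_sq]

theorem fracForm_self {n : ℕ} (s : ℝ) (Ω : Set (Rn n)) (u : hsTildeSubmodule s Ω) :
    fracForm s (u : L2 n) u = ‖halfLaplacian s Ω u‖ ^ 2 := by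
  rw [← inner_halfLaplacian s Ω, real_inner_self_eq_norm_sq]

theorem sqrt_fracForm_self {n : ℕ} (s : ℝ) (Ω : Set (Rn n)) (u : hsTildeSubmodule s Ω) :
    √(fracForm s (u : L2 n) u) = ‖halfLaplacian s Ω u‖ := by
  rw [fracForm_self s Ω, Real.sqrt_sq (norm_nonneg _)]

/-- The volume of `closure Ω`, enlarged by one so that it is positive. -/
def closureVolume {n : ℕ} (Ω : Set (Rn n)) : ℝ := volume.real (closure Ω) + 1

theorem closureVolume_pos {n : ℕ} (Ω : Set (Rn n)) : 0 < closureVolume Ω := by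
  unfold closureVolume; positivity

theorem volume_support_le {n : ℕ} {s : ℝ} {Ω : Set (Rn n)} (hΩb : Bornology.IsBounded Ω) {u : L2 n}
    (hu : u ∈ HsTilde s Ω) : volume {x | u x ≠ 0} ≤ ENNReal.ofReal (closureVolume Ω) := by
  have h1 : volume {x | u x ≠ 0} ≤ volume (closure Ω) := by
    apply measure_mono_ae
    filter_upwards [hu.2] with x hx h
    by_contra h2
    exact h (hx h2)
  have h2 : volume (closure Ω) ≠ ∞ := hΩb.closure.measure_lt_top.ne
  refine h1.trans ?_
  rw [← ofReal_measureReal h2]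
  apply ENNReal.ofReal_le_ofReal
  unfold closureVolume; linarith

/-- Poincaré inequality. -/
theorem exists_poincare {n : ℕ} (hn : 1 ≤ n) {s : ℝ} (hs0 : 0 < s) (hs1 : s < 1)
    {Ω : Set (Rn n)} (hΩb : Bornology.IsBounded Ω) :
    ∃ K : NNReal, ∀ u : hsTildeSubmodule s Ω, ‖u‖ ≤ K * ‖halfLaplacian s Ω u‖ := by
  obtain ⟨C, hC0, hC⟩ := exists_faberKrahn hn hs0 hs1
  set D := C * closureVolume Ω ^ (2 * s / n)
  have hD : 0 ≤ D := mul_nonneg hC0 (Real.rpow_nonneg (closureVolume_pos Ω).le _)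
  refine ⟨(√D).toNNReal, fun u => ?_⟩
  have h1 := hC u _ (closureVolume_pos Ω) (volume_support_le hΩb u.2)
  rw [← enorm_halfLaplacian_sq s Ω u, ← ofReal_norm, ← ofReal_norm, ← ENNReal.ofReal_pow (norm_nonneg _),
    ← ENNReal.ofReal_pow (norm_nonneg _), ← ENNReal.ofReal_mul hD,
    ENNReal.ofReal_le_ofReal_iff (by positivity)] at h1
  rw [Real.coe_toNNReal _ (Real.sqrt_nonneg _)]
  refine abs_le_of_sq_le_sq' ?_ (by positivity) |>.2
  rw [mul_pow, Real.sq_sqrt hD]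
  exact h1

theorem eq_zero_of_fracForm_self {n : ℕ} (hn : 1 ≤ n) {s : ℝ} (hs0 : 0 < s) (hs1 : s < 1)
    {Ω : Set (Rn n)} (hΩb : Bornology.IsBounded Ω) {u : L2 n} (hu : u ∈ HsTilde s Ω)
    (h : fracForm s u u ≤ 0) : u = 0 := by
  obtain ⟨K, hK⟩ := exists_poincare hn hs0 hs1 hΩb
  lift u to hsTildeSubmodule s Ω using hu
  rw [fracForm_self s Ω] at h
  have h1 : ‖halfLaplacian s Ω u‖ = 0 := by
    nlinarith [norm_nonneg (halfLaplacian s Ω u)]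
  have h2 := hK u
  rw [h1, mul_zero] at h2
  have h3 : u = 0 := norm_eq_zero.1 (le_antisymm h2 (norm_nonneg _))
  rw [h3]; rfl

/-- An L²-convergent sequence has a subsequence converging a.e., and closed pointwise constraints
survive. It serves both for the vanishing outside the closure of Ω and for the obstacle. -/
theorem isClosed_setOf_ae_mem {n : ℕ} {ν : Measure (Rn n)} (hν : ν ≪ volume) {P : Rn n → Set ℝ}
    (hP : ∀ x, IsClosed (P x)) : IsClosed {v : L2 n | ∀ᵐ x ∂ν, v x ∈ P x} := by
  refine IsSeqClosed.isClosed fun v w hv hw => ?_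
  obtain ⟨φ, -, hφ⟩ := (tendstoInMeasure_of_tendsto_Lp hw).exists_seq_tendsto_ae
  have h1 : ∀ᵐ x ∂ν, ∀ j, v j x ∈ P x := ae_all_iff.2 hv
  show ∀ᵐ x ∂ν, w x ∈ P x
  filter_upwards [h1, hν.ae_le hφ] with x h2 h3
  exact (hP x).mem_of_tendsto h3 (Eventually.of_forall fun j => h2 _)

/-- By Poincaré a sequence converging in energy is Cauchy in L²; its L² limit is then shown to carry
the energy limit. -/
theorem isComplete_halfLaplacian_image {n : ℕ} (hn : 1 ≤ n) {s : ℝ} (hs0 : 0 < s) (hs1 : s < 1)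
    {Ω : Set (Rn n)} (hΩb : Bornology.IsBounded Ω) {S : Set (L2 n)} (hS : IsClosed S) :
    IsComplete (halfLaplacian s Ω '' {u | (u : L2 n) ∈ S}) := by
  obtain ⟨K, hK⟩ := exists_poincare hn hs0 hs1 hΩb
  refine IsClosed.isComplete (IsSeqClosed.isClosed fun g g' hg hg' => ?_)
  choose u huS hu using hg
  have hcauchy : CauchySeq fun j => (u j : L2 n) := by
    have h1 := hg'.cauchySeq
    rw [Metric.cauchySeq_iff] at h1 ⊢
    intro ε hε
    obtain ⟨N, hN⟩ := h1 (ε / (K + 1)) (by positivity)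
    refine ⟨N, fun i hi j hj => ?_⟩
    have h2 := hN i hi j hj
    have h3 := hK (u i - u j)
    rw [dist_eq_norm, ← hu, ← hu, ← map_sub, lt_div_iff₀ (by positivity)] at h2
    rw [dist_eq_norm]
    calc ‖(u i : L2 n) - u j‖ = ‖u i - u j‖ := rfl
      _ ≤ _ := h3
      _ ≤ ‖halfLaplacian s Ω (u i - u j)‖ * (K + 1) := by
        nlinarith [norm_nonneg (halfLaplacian s Ω (u i - u j))]
      _ < ε := h2
  obtain ⟨w, hw⟩ := cauchySeq_tendsto_of_complete hcauchy
  have hfour : Tendsto (fun j => fourierCLM (u j : L2 n)) atTop (𝓝 (fourierCLM w)) :=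
    (fourierCLM.continuous.tendsto w).comp hw
  -- Two nested subsequences make both the Fourier transforms and their weighted versions converge
  -- a.e., which identifies `g'`.
  obtain ⟨φ, hφm, hφ⟩ := (tendstoInMeasure_of_tendsto_Lp hfour).exists_seq_tendsto_ae
  obtain ⟨χ, hχm, hχ⟩ := (tendstoInMeasure_of_tendsto_Lp
    (hg'.comp hφm.tendsto_atTop)).exists_seq_tendsto_ae
  have hae : g' =ᵐ[volume] fun ξ => (symbol (s / 2) ξ : ℂ) * fourierL2 w ξ := by
    have h1 := ae_all_iff.2 fun j => coeFn_halfLaplacian s Ω (u j)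
    filter_upwards [h1, hφ, hχ] with ξ h2 h3 h4
    refine tendsto_nhds_unique h4 ?_
    have h5 := (h3.comp hχm.tendsto_atTop).const_mul (symbol (s / 2) ξ : ℂ)
    refine h5.congr fun j => ?_
    simp only [Function.comp_apply, ← hu, h2]
    rfl
  have hwH : w ∈ hsTildeSubmodule s Ω := by
    refine ⟨(Lp.memLp g').ae_eq hae, ?_⟩
    have hcl := isClosed_setOf_ae_mem (Measure.AbsolutelyContinuous.refl (volume : Measure (Rn n)))
      (P := fun x => {y | x ∉ closure Ω → y = 0}) (fun x => by
        by_cases hx : x ∈ closure Ω <;> simp [hx])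
    exact hcl.mem_of_tendsto hw (Eventually.of_forall fun j => (u j).2.2)
  refine ⟨⟨w, hwH⟩, hS.mem_of_tendsto hw (Eventually.of_forall huS), ?_⟩
  exact Lp.ext ((coeFn_halfLaplacian s Ω ⟨w, hwH⟩).trans hae.symm)

/-! ### Subcritical Sobolev embedding from level sets -/

/-- The rate q = 2/(1-θ) is the fixed point of q = 2 + qθ, so 2^{-kq} reproduces itself under the
recursion; `hD2` absorbs the constant. -/
theorem decay_of_recursion {a : ℕ → ℝ} {V C D θ : ℝ} (ha : ∀ k, 0 ≤ a k) (hV : 0 < V)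
    (hθ0 : 0 < θ) (hθ1 : θ < 1) (h0 : a 0 ≤ V)
    (hrec : ∀ k, a (k + 1) ≤ C * 4 ^ (-(k : ℝ)) * a k ^ θ)
    (hD1 : V ≤ D) (hD2 : 2 ^ (2 / (1 - θ)) * C ≤ D ^ (1 - θ)) (k : ℕ) :
    a k ≤ D * 2 ^ (-(k * (2 / (1 - θ)))) := by
  have hD : 0 < D := hV.trans_le hD1
  have h1θ : 0 < 1 - θ := by linarith
  induction k with
  | zero => simpa using h0.trans hD1
  | succ k ih =>
    set q := 2 / (1 - θ) with hq
    have hqθ : q = 2 + q * θ := by rw [hq]; field_simp; ring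
    have h4 : (4 : ℝ) ^ (-(k : ℝ)) = 2 ^ (-(k * 2) : ℝ) := by
      rw [show (4 : ℝ) = 2 ^ (2 : ℝ) by norm_num, ← Real.rpow_mul (by norm_num)]
      congr 1; ring
    have hCD : C ≤ 2 ^ (-q) * D ^ (1 - θ) := by
      rw [Real.rpow_neg (by norm_num), ← div_eq_inv_mul, le_div_iff₀ (by positivity), mul_comm]
      exact hD2
    calc a (k + 1) ≤ C * 4 ^ (-(k : ℝ)) * a k ^ θ := hrec k
      _ ≤ (2 ^ (-q) * D ^ (1 - θ)) * 4 ^ (-(k : ℝ)) * (D * 2 ^ (-(k * q))) ^ θ := by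
        have := ha k
        gcongr
      _ = (D ^ (1 - θ) * D ^ θ) * (2 ^ (-q) * 2 ^ (-(k * 2) : ℝ) * 2 ^ (-(k * q) * θ)) := by
        rw [h4, Real.mul_rpow hD.le (by positivity), ← Real.rpow_mul (by norm_num)]
        ring
      _ = D * 2 ^ (-((k + 1 : ℕ) * q)) := by
        rw [← Real.rpow_add hD, ← Real.rpow_add (by norm_num), ← Real.rpow_add (by norm_num)]
        congr 1
        · simp
        · congr 1
          push_cast
          linear_combination (k : ℝ) * hqθ

/-- The truncation `x ↦ (|x| - t)⁺`. -/
def excess (t x : ℝ) : ℝ := max (|x| - t) 0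

theorem lipschitzWith_excess (t : ℝ) : LipschitzWith 1 (excess t) := by
  refine LipschitzWith.max_const ?_ 0
  have h : LipschitzWith 1 fun x : ℝ => |x| := by
    exact lipschitzWith_one_norm (E := ℝ)
  refine LipschitzWith.of_dist_le_mul fun x y => ?_
  simpa [Real.dist_eq] using h.dist_le_mul x y

theorem excess_zero {t : ℝ} (ht : 0 ≤ t) : excess t 0 = 0 := by
  simp [excess, ht]

/-- Faber–Krahn for w = (|u| - t)⁺, supported in {|u| ≥ t} and at least t on {|u| ≥ 2t}. The
exponent 2s/n may be lowered to θ because level sets have bounded measure; this leaves room for θ <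
1 even when 2s ≥ n. -/
theorem exists_distribution_recursion {n : ℕ} (hn : 1 ≤ n) {s : ℝ} (hs0 : 0 < s) (hs1 : s < 1)
    {Ω : Set (Rn n)} (hΩb : Bornology.IsBounded Ω) {θ : ℝ} (hθ : θ ≤ 2 * s / n) :
    ∃ C : ℝ, 0 ≤ C ∧ ∀ u ∈ HsTilde s Ω, energy s u ≤ 1 → ∀ t : ℝ, 0 < t →
      t ^ 2 * volume.real {x | 2 * t ≤ |u x|} ≤ C * volume.real {x | t ≤ |u x|} ^ θ := by
  obtain ⟨C, hC0, hC⟩ := exists_faberKrahn hn hs0 hs1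
  set V := closureVolume Ω
  have hV : 0 < V := closureVolume_pos Ω
  refine ⟨C * V ^ (2 * s / n - θ), by positivity, fun u hu hE t ht => ?_⟩
  have hfin : ∀ τ : ℝ, 0 < τ → volume {x | τ ≤ |u x|} ≤ ENNReal.ofReal V := fun τ hτ => by
    refine (measure_mono fun x hx => ?_).trans (volume_support_le hΩb hu)
    intro h0
    have hx' : τ ≤ |u x| := hx
    rw [h0, abs_zero] at hx'
    linarith
  have hfin' : ∀ τ : ℝ, 0 < τ → volume {x | τ ≤ |u x|} ≠ ∞ := fun τ hτ =>
    ((hfin τ hτ).trans_lt ENNReal.ofReal_lt_top).ne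
  -- Faber–Krahn needs positive m; a null level set is trivial.
  rcases eq_or_lt_of_le (measureReal_nonneg (μ := volume) (s := {x | t ≤ |u x|})) with hm | hm
  · have h1 : volume.real {x | 2 * t ≤ |u x|} ≤ volume.real {x | t ≤ |u x|} :=
      measureReal_mono (fun x (hx : 2 * t ≤ |u x|) => by
        show t ≤ |u x|
        linarith) (hfin' t ht)
    have h2 : volume.real {x | 2 * t ≤ |u x|} = 0 := le_antisymm (h1.trans hm.symm.le) measureReal_nonneg
    rw [h2, mul_zero]
    positivity
  set m := volume.real {x | t ≤ |u x|}
  have hmV : m ≤ V := ENNReal.toReal_le_of_le_ofReal hV.le (hfin t ht)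
  set w := (lipschitzWith_excess t).compLp (excess_zero ht.le) u
  have hw : w =ᵐ[volume] fun x => excess t (u x) :=
    (lipschitzWith_excess t).coeFn_compLp (excess_zero ht.le) u
  have hsupp : volume {x | w x ≠ 0} ≤ ENNReal.ofReal m := by
    rw [ofReal_measureReal (hfin' t ht)]
    apply measure_mono_ae
    filter_upwards [hw] with x hx (h : w x ≠ 0)
    show t ≤ |u x|
    by_contra h2
    rw [hx, excess, max_eq_right (by linarith)] at h
    exact h rfl
  have h1 := hC w m hm hsupp
  have h2 : energy s w ≤ 1 := (energy_compLp_le hn hs0 hs1 _ _ u).trans hE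
  have h3 : ENNReal.ofReal (t ^ 2 * volume.real {x | 2 * t ≤ |u x|}) ≤ ‖w‖ₑ ^ 2 := by
    rw [ENNReal.ofReal_mul (by positivity), ofReal_measureReal (hfin' _ (by positivity)),
      ← lintegral_enorm_sq_eq]
    refine le_trans ?_ (mul_meas_ge_le_lintegral
      ((Lp.stronglyMeasurable w).measurable.enorm.pow_const 2) (ENNReal.ofReal (t ^ 2)))
    refine mul_le_mul_right (measure_mono_ae ?_) _
    filter_upwards [hw] with x hx (h : 2 * t ≤ |u x|)
    show ENNReal.ofReal (t ^ 2) ≤ ‖w x‖ₑ ^ 2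
    rw [hx, ← ofReal_norm, ENNReal.ofReal_pow ht.le]
    gcongr
    rw [excess, Real.norm_eq_abs]
    exact le_trans (by linarith [le_max_left (|u x| - t) 0]) (le_abs_self _)
  have h4 : ENNReal.ofReal (t ^ 2 * volume.real {x | 2 * t ≤ |u x|}) ≤
      ENNReal.ofReal (C * m ^ (2 * s / n)) :=
    h3.trans (h1.trans ((mul_le_mul_right h2 _).trans (mul_one _).le))
  rw [ENNReal.ofReal_le_ofReal_iff (by positivity)] at h4
  refine h4.trans ?_
  rw [mul_assoc]
  refine mul_le_mul_of_nonneg_left ?_ hC0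
  calc m ^ (2 * s / n) = m ^ (2 * s / n - θ) * m ^ θ := by
        rw [← Real.rpow_add hm]; congr 1; ring
    _ ≤ V ^ (2 * s / n - θ) * m ^ θ := by
        gcongr

theorem rpow_le_one_add_tsum (y : ℝ) {r : ℝ} (hr : 0 < r) :
    ‖y‖ₑ ^ r ≤ 1 + ∑' k : ℕ, ENNReal.ofReal (2 ^ ((k + 1 : ℕ) * r)) * {z : ℝ | 2 ^ k ≤ |z|}.indicator 1 y := by
  rcases le_or_gt |y| 1 with h | h
  · refine le_trans ?_ le_self_add
    rw [← ofReal_norm, Real.norm_eq_abs, ENNReal.ofReal_rpow_of_nonneg (abs_nonneg y) hr.le]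
    exact ENNReal.ofReal_le_one.2 (Real.rpow_le_one (abs_nonneg y) h hr.le)
  · obtain ⟨k, hk1, hk2⟩ := exists_nat_pow_near h.le (one_lt_two (α := ℝ))
    refine le_trans ?_ le_add_self
    refine le_trans ?_ (ENNReal.le_tsum k)
    rw [Set.indicator_of_mem (by exact hk1), Pi.one_apply, mul_one, ← ofReal_norm, Real.norm_eq_abs,
      ENNReal.ofReal_rpow_of_nonneg (abs_nonneg y) hr.le]
    apply ENNReal.ofReal_le_ofReal
    rw [Real.rpow_mul (by norm_num), Real.rpow_natCast]
    exact Real.rpow_le_rpow (abs_nonneg y) hk2.le hr.le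

/-- Subcritical Sobolev embedding. -/
theorem exists_eLpNorm_le {n : ℕ} (hn : 1 ≤ n) {s : ℝ} (hs0 : 0 < s) (hs1 : s < 1)
    {Ω : Set (Rn n)} (hΩb : Bornology.IsBounded Ω) {θ r : ℝ} (hθ0 : 0 < θ) (hθ1 : θ < 1)
    (hθ : θ ≤ 2 * s / n) (hr0 : 0 < r) (hr : r < 2 / (1 - θ)) :
    ∃ S : ℝ, 0 ≤ S ∧ ∀ u : hsTildeSubmodule s Ω,
      eLpNorm (u : L2 n) (ENNReal.ofReal r) volume ≤ ENNReal.ofReal (S * ‖halfLaplacian s Ω u‖) := by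
  obtain ⟨C, hC0, hC⟩ := exists_distribution_recursion hn hs0 hs1 hΩb hθ
  obtain ⟨K, hK⟩ := exists_poincare hn hs0 hs1 hΩb
  set V := closureVolume Ω
  have hV : 0 < V := closureVolume_pos Ω
  have h1θ : 0 < 1 - θ := by linarith
  set q := 2 / (1 - θ)
  obtain ⟨D, hD1, hD2⟩ : ∃ D : ℝ, V ≤ D ∧ 2 ^ q * C ≤ D ^ (1 - θ) := by
    refine ⟨max V ((2 ^ q * C) ^ (1 / (1 - θ))), le_max_left _ _, ?_⟩
    calc 2 ^ q * C = ((2 ^ q * C) ^ (1 / (1 - θ))) ^ (1 - θ) := by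
          rw [← Real.rpow_mul (by positivity), one_div_mul_cancel h1θ.ne', Real.rpow_one]
      _ ≤ _ := Real.rpow_le_rpow (by positivity) (le_max_right _ _) h1θ.le
  have hD : 0 < D := hV.trans_le hD1
  -- Dyadic shells contribute about 2^{kr} 2^{-kq}, summable exactly because r < q.
  have hρ : (2 : ℝ) ^ (r - q) < 1 := Real.rpow_lt_one_of_one_lt_of_neg one_lt_two (by linarith)
  have hsum : Summable fun k : ℕ => D * 2 ^ r * (2 ^ (r - q) : ℝ) ^ k :=
    (summable_geometric_of_lt_one (by positivity) hρ).mul_left _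
  set B := V + ∑' k : ℕ, D * 2 ^ r * (2 ^ (r - q) : ℝ) ^ k
  have hB : 0 ≤ B := add_nonneg hV.le (tsum_nonneg fun k => by positivity)
  have unit : ∀ u ∈ HsTilde s Ω, energy s u ≤ 1 → ∫⁻ x, ‖u x‖ₑ ^ r ≤ ENNReal.ofReal B := by
    intro u hu hE
    have hmeas : Measurable fun x => u x := (Lp.stronglyMeasurable u).measurable
    have hset : ∀ k : ℕ, MeasurableSet {x | (2 : ℝ) ^ k ≤ |u x|} := fun k =>
      measurableSet_le measurable_const hmeas.abs
    have hfin : ∀ k : ℕ, volume {x | (2 : ℝ) ^ k ≤ |u x|} ≤ ENNReal.ofReal V := fun k => by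
      refine (measure_mono fun x hx => ?_).trans (volume_support_le hΩb hu)
      intro h0
      change 2 ^ k ≤ |u x| at hx
      rw [h0, abs_zero] at hx
      exact absurd hx (not_le.2 (by positivity))
    have hdecay := decay_of_recursion (a := fun k : ℕ => volume.real {x | (2 : ℝ) ^ k ≤ |u x|})
      (fun k => measureReal_nonneg) hV hθ0 hθ1 (ENNReal.toReal_le_of_le_ofReal hV.le (hfin 0))
      (fun k => by
        have h1 := hC u hu hE (2 ^ k) (by positivity)
        rw [← pow_succ'] at h1
        have h2 : (4 : ℝ) ^ (-(k : ℝ)) = ((2 ^ k) ^ 2)⁻¹ := by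
          rw [Real.rpow_neg (by norm_num), Real.rpow_natCast, ← pow_mul, mul_comm, pow_mul]
          norm_num
        rw [h2, mul_right_comm, ← div_eq_mul_inv, le_div_iff₀ (by positivity), mul_comm]
        exact h1) hD1 hD2
    -- The constant 1 of the dyadic bound is needed only where u ≠ 0, a set of finite measure.
    calc ∫⁻ x, ‖u x‖ₑ ^ r
        ≤ ∫⁻ x, ({x | u x ≠ 0}.indicator 1 x + ∑' k : ℕ, ENNReal.ofReal (2 ^ ((k + 1 : ℕ) * r)) *
            {x | (2 : ℝ) ^ k ≤ |u x|}.indicator 1 x) := by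
          refine lintegral_mono fun x => ?_
          by_cases h0 : u x = 0
          · simp [h0, hr0]
          · have := rpow_le_one_add_tsum (u x) hr0
            rw [Set.indicator_of_mem (by exact h0)]
            exact this
      _ = volume {x | u x ≠ 0} + ∑' k : ℕ, ENNReal.ofReal (2 ^ ((k + 1 : ℕ) * r)) *
            volume {x | (2 : ℝ) ^ k ≤ |u x|} := by
          have hm0 : MeasurableSet {x | u x ≠ 0} := hmeas (measurableSet_singleton (0 : ℝ)).compl
          rw [lintegral_add_left (measurable_one.indicator hm0), lintegral_indicator_one hm0,
            lintegral_tsum fun k => ((measurable_one.indicator (hset k)).const_mul _).aemeasurable]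
          congr 2 with k
          rw [lintegral_const_mul _ (measurable_one.indicator (hset k)), lintegral_indicator_one (hset k)]
      _ ≤ ENNReal.ofReal V + ∑' k : ℕ, ENNReal.ofReal (D * 2 ^ r * (2 ^ (r - q) : ℝ) ^ k) := by
          refine add_le_add (volume_support_le hΩb hu) (ENNReal.tsum_le_tsum fun k => ?_)
          rw [← ofReal_measureReal ((hfin k).trans_lt ENNReal.ofReal_lt_top).ne,
            ← ENNReal.ofReal_mul (by positivity)]
          apply ENNReal.ofReal_le_ofReal
          calc (2 : ℝ) ^ ((k + 1 : ℕ) * r) * volume.real {x | (2 : ℝ) ^ k ≤ |u x|}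
              ≤ 2 ^ ((k + 1 : ℕ) * r) * (D * 2 ^ (-(k * q))) :=
                mul_le_mul_of_nonneg_left (hdecay k) (by positivity)
            _ = D * (2 ^ ((k + 1 : ℕ) * r) * 2 ^ (-(k * q))) := by ring
            _ = D * 2 ^ r * (2 ^ (r - q) : ℝ) ^ k := by
                rw [mul_assoc, ← Real.rpow_natCast, ← Real.rpow_mul (by norm_num),
                  ← Real.rpow_add (by norm_num), ← Real.rpow_add (by norm_num)]
                congr 2; push_cast; ring
      _ = ENNReal.ofReal B := by
          rw [ENNReal.ofReal_add hV.le (tsum_nonneg fun k => by positivity),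
            ENNReal.ofReal_tsum_of_nonneg (fun k => by positivity) hsum]
  have hr' : ENNReal.ofReal r ≠ 0 := by simpa using hr0
  have unit' : ∀ u ∈ HsTilde s Ω, energy s u ≤ 1 →
      eLpNorm u (ENNReal.ofReal r) volume ≤ ENNReal.ofReal (B ^ (1 / r)) := by
    intro u hu hE
    rw [eLpNorm_eq_lintegral_rpow_enorm_toReal hr' ENNReal.ofReal_ne_top,
      ENNReal.toReal_ofReal hr0.le, ← ENNReal.ofReal_rpow_of_nonneg hB (by positivity)]
    exact ENNReal.rpow_le_rpow (unit u hu hE) (by positivity)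
  refine ⟨B ^ (1 / r), by positivity, fun u => ?_⟩
  rcases eq_or_ne (halfLaplacian s Ω u) 0 with h0 | h0
  · have h1 := hK u
    rw [h0, norm_zero, mul_zero] at h1
    have h2 : u = 0 := norm_eq_zero.1 (le_antisymm h1 (norm_nonneg _))
    have h3 : ((u : L2 n) : Rn n → ℝ) =ᵐ[volume] 0 := by rw [h2]; exact Lp.coeFn_zero ℝ 2 volume
    rw [eLpNorm_congr_ae h3, eLpNorm_zero]
    exact zero_le
  · set N := ‖halfLaplacian s Ω u‖
    have hN : 0 < N := norm_pos_iff.2 h0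
    have h1 : energy s ((N⁻¹ • u : hsTildeSubmodule s Ω) : L2 n) ≤ 1 := by
      rw [← enorm_halfLaplacian_sq s Ω, ← ofReal_norm, map_smul, norm_smul, norm_inv, norm_norm,
        inv_mul_cancel₀ hN.ne']
      simp
    have h2 := unit' _ (N⁻¹ • u).2 h1
    have h3 : eLpNorm (u : L2 n) (ENNReal.ofReal r) volume = ENNReal.ofReal N *
        eLpNorm ((N⁻¹ • u : hsTildeSubmodule s Ω) : L2 n) (ENNReal.ofReal r) volume := by
      have h4 : ((u : L2 n) : Rn n → ℝ) =ᵐ[volume]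
          N • (((N⁻¹ • u : hsTildeSubmodule s Ω) : L2 n) : Rn n → ℝ) := by
        filter_upwards [Lp.coeFn_smul N⁻¹ (u : L2 n)] with x hx
        rw [Pi.smul_apply, Submodule.coe_smul, hx, Pi.smul_apply, smul_smul, mul_inv_cancel₀ hN.ne', one_smul]
      rw [eLpNorm_congr_ae h4, eLpNorm_const_smul, ← ofReal_norm, Real.norm_of_nonneg hN.le]
    rw [h3, mul_comm, ENNReal.ofReal_mul (by positivity)]
    gcongr

/-- Both conditions on p say 1/p < min(1, 2s/n). Any θ strictly between gives 2/(1-θ) > 2/(1-1/p) =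
2p', leaving room for r. -/
theorem exists_sobolev {n : ℕ} (hn : 1 ≤ n) {s : ℝ} (hs0 : 0 < s) (hs1 : s < 1)
    {Ω : Set (Rn n)} (hΩb : Bornology.IsBounded Ω) {p : ℝ} (hp1 : 1 < p) (hp : (n : ℝ) / (2 * s) < p) :
    ∃ r S : ℝ, 2 * p.conjExponent < r ∧ 0 ≤ S ∧ ∀ u : hsTildeSubmodule s Ω,
      eLpNorm (u : L2 n) (ENNReal.ofReal r) volume ≤ ENNReal.ofReal (S * ‖halfLaplacian s Ω u‖) := by
  have hn' : (0 : ℝ) < n := by exact_mod_cast hn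
  have h1 : 1 / p < 1 := by rw [div_lt_one (by linarith)]; exact hp1
  have h2 : 1 / p < 2 * s / n := by
    rw [div_lt_div_iff₀ (by linarith) hn', one_mul]
    rwa [div_lt_iff₀ (by positivity), mul_comm] at hp
  obtain ⟨θ, hθ1, hθ2⟩ := exists_between (lt_min h1 h2)
  rw [lt_min_iff] at hθ2
  have hθ0 : 0 < θ := lt_trans (by positivity) hθ1
  have hconj := Real.HolderConjugate.conjExponent hp1
  have h3 : 2 * p.conjExponent < 2 / (1 - θ) := by
    have h4 : p.conjExponent = (1 - 1 / p)⁻¹ := by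
      rw [one_div, hconj.one_sub_inv, inv_inv]
    have h5 : 0 < 1 - θ := by linarith [hθ2.1]
    rw [h4, ← div_eq_mul_inv]
    exact div_lt_div_of_pos_left (by norm_num) h5 (by linarith)
  obtain ⟨r, hr1, hr2⟩ := exists_between h3
  have hr0 : 0 < r := lt_trans (mul_pos two_pos hconj.symm.pos) hr1
  obtain ⟨S, hS0, hS⟩ := exists_eLpNorm_le hn hs0 hs1 hΩb hθ0 hθ2.1 hθ2.2.le hr0 hr2
  exact ⟨r, S, hr1, hS0, hS⟩

/-! ### The right-hand side as a functional on the energy space -/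

theorem eLpNorm_le_of_support {n : ℕ} (u : L2 n) {q r m : ℝ} (hq : 0 < q) (hqr : q ≤ r)
    (hm : volume {x | u x ≠ 0} ≤ ENNReal.ofReal m) :
    eLpNorm u (ENNReal.ofReal q) volume ≤
      eLpNorm u (ENNReal.ofReal r) volume * ENNReal.ofReal m ^ (1 / q - 1 / r) := by
  have hsub : Function.support (u : Rn n → ℝ) ⊆ {x | u x ≠ 0} := fun x hx => hx
  have hr : 0 < r := hq.trans_le hqr
  have h1 : eLpNorm u (ENNReal.ofReal q) (volume.restrict {x | u x ≠ 0}) =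
      eLpNorm u (ENNReal.ofReal q) volume := eLpNorm_restrict_eq_of_support_subset hsub
  have h2 : eLpNorm u (ENNReal.ofReal r) (volume.restrict {x | u x ≠ 0}) =
      eLpNorm u (ENNReal.ofReal r) volume := eLpNorm_restrict_eq_of_support_subset hsub
  rw [← h1, ← h2]
  refine (eLpNorm_le_eLpNorm_mul_rpow_measure_univ (ENNReal.ofReal_le_ofReal hqr)
    (Lp.aestronglyMeasurable u).restrict).trans ?_
  rw [ENNReal.toReal_ofReal hq.le, ENNReal.toReal_ofReal hr.le, Measure.restrict_apply_univ]
  gcongr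
  rw [sub_nonneg]
  exact one_div_le_one_div_of_le hq hqr

/-- Hölder with p and p', then again from p' to r on the support of u. With m the volume bound for
the closure of Ω this gives duality; with m the measure of a superlevel set it drives the iteration.
-/
theorem integrable_mul_and_integral_le {n : ℕ} {s : ℝ} {Ω : Set (Rn n)} {p r S m : ℝ} (hp1 : 1 < p)
    (hr : p.conjExponent ≤ r) (hS0 : 0 ≤ S) (hm0 : 0 ≤ m)
    {u : hsTildeSubmodule s Ω}
    (hS : eLpNorm (u : L2 n) (ENNReal.ofReal r) volume ≤ ENNReal.ofReal (S * ‖halfLaplacian s Ω u‖))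
    (hm : volume {x | (u : L2 n) x ≠ 0} ≤ ENNReal.ofReal m)
    {g : Rn n → ℝ} (hg : MemLp g (ENNReal.ofReal p) (volume.restrict Ω)) :
    IntegrableOn (fun x => g x * (u : L2 n) x) Ω volume ∧
      ∫ x in Ω, |g x * (u : L2 n) x| ≤ normLp Ω (ENNReal.ofReal p) g *
        (S * ‖halfLaplacian s Ω u‖ * m ^ (1 / p.conjExponent - 1 / r)) := by
  have hconj := Real.HolderConjugate.conjExponent hp1
  have := hconj.ennrealOfReal
  have hq0 := hconj.symm.pos
  have hexp : 0 ≤ 1 / p.conjExponent - 1 / r := by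
    rw [sub_nonneg]; exact one_div_le_one_div_of_le hq0 hr
  have h1 : eLpNorm (u : L2 n) (ENNReal.ofReal p.conjExponent) (volume.restrict Ω) ≤
      ENNReal.ofReal (S * ‖halfLaplacian s Ω u‖ * m ^ (1 / p.conjExponent - 1 / r)) := by
    refine (eLpNorm_mono_measure _ Measure.restrict_le_self).trans
      ((eLpNorm_le_of_support _ hq0 hr hm).trans ?_)
    rw [ENNReal.ofReal_mul (by positivity), ← ENNReal.ofReal_rpow_of_nonneg hm0 hexp]
    gcongr
  have hu : MemLp (u : L2 n) (ENNReal.ofReal p.conjExponent) (volume.restrict Ω) :=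
    ⟨(Lp.aestronglyMeasurable _).restrict, h1.trans_lt ENNReal.ofReal_lt_top⟩
  have hint : Integrable (fun x => g x * (u : L2 n) x) (volume.restrict Ω) := hg.integrable_mul hu
  refine ⟨hint, ?_⟩
  have h2 : eLpNorm (fun x => g x * (u : L2 n) x) 1 (volume.restrict Ω) ≤
      eLpNorm g (ENNReal.ofReal p) (volume.restrict Ω) *
        eLpNorm (u : L2 n) (ENNReal.ofReal p.conjExponent) (volume.restrict Ω) := by
    have h := eLpNorm_smul_le_mul_eLpNorm (p := ENNReal.ofReal p)
      (q := ENNReal.ofReal p.conjExponent) (r := 1) hu.1 hg.1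
    exact h
  rw [eLpNorm_one_eq_lintegral_enorm] at h2
  have h3 : ∫ x in Ω, |g x * (u : L2 n) x| =
      (∫⁻ x in Ω, ‖g x * (u : L2 n) x‖ₑ).toReal :=
    integral_norm_eq_lintegral_enorm hint.1
  rw [h3]
  clear h3
  refine ENNReal.toReal_le_of_le_ofReal (by unfold normLp; positivity) (h2.trans ?_)
  rw [ENNReal.ofReal_mul (by unfold normLp; positivity), normLp, ENNReal.ofReal_toReal hg.2.ne]
  gcongr

theorem memDual_of_memLp {n : ℕ} (hn : 1 ≤ n) {s : ℝ} (hs0 : 0 < s) (hs1 : s < 1)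
    {Ω : Set (Rn n)} (hΩb : Bornology.IsBounded Ω) {p : ℝ} (hp1 : 1 < p) (hp : (n : ℝ) / (2 * s) < p)
    {f : Rn n → ℝ} (hf : MemLp f (ENNReal.ofReal p) (volume.restrict Ω)) : MemDual s Ω f := by
  obtain ⟨r, S, hr, hS0, hS⟩ := exists_sobolev hn hs0 hs1 hΩb hp1 hp
  have hq0 := (Real.HolderConjugate.conjExponent hp1).symm.pos
  refine ⟨normLp Ω (ENNReal.ofReal p) f * (S * closureVolume Ω ^ (1 / p.conjExponent - 1 / r)),
    fun v hv => ?_⟩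
  lift v to hsTildeSubmodule s Ω using hv
  obtain ⟨h1, h2⟩ := integrable_mul_and_integral_le hp1 (by linarith) hS0 (closureVolume_pos Ω).le
    (hS v) (volume_support_le hΩb v.2) hf
  refine ⟨h1, (abs_integral_le_integral_abs).trans (h2.trans (le_of_eq ?_))⟩
  rw [sqrt_fracForm_self s Ω]
  ring

theorem pairing_add {n : ℕ} {Ω : Set (Rn n)} {f : Rn n → ℝ} {u v : L2 n}
    (hu : IntegrableOn (fun x => f x * u x) Ω volume) (hv : IntegrableOn (fun x => f x * v x) Ω volume) :
    pairing Ω f (u + v) = pairing Ω f u + pairing Ω f v := by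
  rw [pairing, pairing, pairing, ← integral_add hu hv]
  refine integral_congr_ae (ae_restrict_of_ae ?_)
  filter_upwards [Lp.coeFn_add u v] with x hx
  rw [hx, Pi.add_apply, mul_add]

theorem pairing_smul {n : ℕ} (Ω : Set (Rn n)) (f : Rn n → ℝ) (c : ℝ) (u : L2 n) :
    pairing Ω f (c • u) = c * pairing Ω f u := by
  rw [pairing, pairing, ← integral_const_mul]
  refine integral_congr_ae (ae_restrict_of_ae ?_)
  filter_upwards [Lp.coeFn_smul c u] with x hx
  rw [hx, Pi.smul_apply, smul_eq_mul]
  ring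

/-! ### Existence and uniqueness -/

theorem injective_halfLaplacian {n : ℕ} (hn : 1 ≤ n) {s : ℝ} (hs0 : 0 < s) (hs1 : s < 1)
    {Ω : Set (Rn n)} (hΩb : Bornology.IsBounded Ω) : Function.Injective (halfLaplacian s Ω) := by
  obtain ⟨K, hK⟩ := exists_poincare hn hs0 hs1 hΩb
  rw [injective_iff_map_eq_zero]
  intro u hu
  have h1 := hK u
  rw [hu, norm_zero, mul_zero] at h1
  exact norm_eq_zero.1 (le_antisymm h1 (norm_nonneg _))

/-- Riesz representation on the range of `halfLaplacian`, which is complete. -/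
theorem existsUnique_solvesDirichlet {n : ℕ} (hn : 1 ≤ n) {s : ℝ} (hs0 : 0 < s) (hs1 : s < 1)
    {Ω : Set (Rn n)} (hΩb : Bornology.IsBounded Ω) {f : Rn n → ℝ} (hf : MemDual s Ω f) :
    ∃! ω : L2 n, SolvesDirichlet s Ω f ω := by
  obtain ⟨C, hC⟩ := hf
  have hinj := injective_halfLaplacian hn hs0 hs1 hΩb
  refine existsUnique_of_exists_of_unique ?_ ?_
  · let e := LinearEquiv.ofInjective (halfLaplacian s Ω) hinj
    have hcomplete : CompleteSpace (LinearMap.range (halfLaplacian s Ω)) := by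
      have h := isComplete_halfLaplacian_image hn hs0 hs1 hΩb isClosed_univ
      have h2 : halfLaplacian s Ω '' {u | (u : L2 n) ∈ Set.univ} =
          (LinearMap.range (halfLaplacian s Ω) : Set (Lp ℂ 2 (volume : Measure (Rn n)))) := by
        ext; simp
      rw [h2] at h
      exact h.completeSpace_coe
    let pair : hsTildeSubmodule s Ω →ₗ[ℝ] ℝ :=
      { toFun := fun u => pairing Ω f u
        map_add' := fun u v => pairing_add (hC u u.2).1 (hC v v.2).1
        map_smul' := fun c u => pairing_smul Ω f c u }
    let l : LinearMap.range (halfLaplacian s Ω) →L[ℝ] ℝ :=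
      (pair ∘ₗ e.symm.toLinearMap).mkContinuous C fun g => by
        obtain ⟨u, rfl⟩ := e.surjective g
        have h := (hC u u.2).2
        rw [sqrt_fracForm_self s Ω] at h
        have he : ((e u : LinearMap.range (halfLaplacian s Ω)) : Lp ℂ 2 (volume : Measure (Rn n)))
            = halfLaplacian s Ω u := rfl
        simpa [pair, ← he] using h
    let g := (InnerProductSpace.toDual ℝ (LinearMap.range (halfLaplacian s Ω))).symm l
    obtain ⟨ω, hω⟩ := e.surjective g
    refine ⟨ω, ω.2, fun v hv => ?_⟩
    lift v to hsTildeSubmodule s Ω using hv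
    have h1 : inner ℝ g (e v) = l (e v) := InnerProductSpace.toDual_symm_apply
    rw [← hω] at h1
    rw [← inner_halfLaplacian s Ω]
    have h2 : l (e v) = pairing Ω f v := by simp [l, pair]
    rw [← h2, ← h1]
    rfl
  · rintro ω₁ ω₂ ⟨h1, h1'⟩ ⟨h2, h2'⟩
    lift ω₁ to hsTildeSubmodule s Ω using h1
    lift ω₂ to hsTildeSubmodule s Ω using h2
    have h3 := (h1' _ (ω₁ - ω₂).2).trans (h2' _ (ω₁ - ω₂).2).symm
    rw [← inner_halfLaplacian s Ω, ← inner_halfLaplacian s Ω, ← sub_eq_zero, ← inner_sub_left,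
      ← map_sub, inner_self_eq_zero (𝕜 := ℝ), ← map_zero (halfLaplacian s Ω)] at h3
    rw [sub_eq_zero.1 (hinj h3)]

/-- Replacing f by (-Δ)^s ω turns the variational inequality into the characterization of u as the
projection of ω onto the obstacle set. -/
theorem solvesObstacle_iff {n : ℕ} {s : ℝ} {Ω : Set (Rn n)} {ψ f : Rn n → ℝ}
    {ω u : hsTildeSubmodule s Ω} (hω : SolvesDirichlet s Ω f ω) :
    SolvesObstacle s Ω ψ f u ↔ (u : L2 n) ∈ obstacleSet s Ω ψ ∧
      ∀ v : hsTildeSubmodule s Ω, (v : L2 n) ∈ obstacleSet s Ω ψ →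
        inner ℝ (halfLaplacian s Ω ω - halfLaplacian s Ω u)
          (halfLaplacian s Ω v - halfLaplacian s Ω u) ≤ 0 := by
  have key : ∀ v : hsTildeSubmodule s Ω,
      fracForm s (u : L2 n) (v - u) - pairing Ω f (v - u) =
      -inner ℝ (halfLaplacian s Ω ω - halfLaplacian s Ω u)
          (halfLaplacian s Ω v - halfLaplacian s Ω u) := by
    intro v
    have h1 := hω.2 _ (v - u).2
    rw [← inner_halfLaplacian s Ω] at h1
    have h2 := inner_halfLaplacian s Ω u (v - u)
    rw [Submodule.coe_sub] at h1 h2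
    rw [← h1, ← h2, ← inner_sub_left, ← map_sub (halfLaplacian s Ω) v u, ← inner_neg_left, neg_sub]
  refine and_congr_right fun _ => ⟨fun h v hv => ?_, fun h v hv => ?_⟩
  · have := h v hv
    rw [key] at this
    linarith
  · have hv' : v ∈ hsTildeSubmodule s Ω := hv.1
    lift v to hsTildeSubmodule s Ω using hv'
    rw [key]
    linarith [h v hv]

theorem isClosed_setOf_ge {n : ℕ} (Ω : Set (Rn n)) (ψ : Rn n → ℝ) :
    IsClosed {v : L2 n | ∀ᵐ x ∂(volume.restrict Ω), ψ x ≤ v x} :=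
  isClosed_setOf_ae_mem (P := fun x => Set.Ici (ψ x)) Measure.absolutelyContinuous_restrict
    fun _ => isClosed_Ici

theorem existsUnique_solvesObstacle {n : ℕ} (hn : 1 ≤ n) {s : ℝ} (hs0 : 0 < s) (hs1 : s < 1)
    {Ω : Set (Rn n)} (hΩb : Bornology.IsBounded Ω) {ψ f : Rn n → ℝ} (hf : MemDual s Ω f)
    (hne : (obstacleSet s Ω ψ).Nonempty) : ∃! u : L2 n, SolvesObstacle s Ω ψ f u := by
  obtain ⟨ω, hω, -⟩ := existsUnique_solvesDirichlet hn hs0 hs1 hΩb hf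
  have hωH : ω ∈ hsTildeSubmodule s Ω := hω.1
  lift ω to hsTildeSubmodule s Ω using hωH
  refine existsUnique_of_exists_of_unique ?_ ?_
  · set Kset := halfLaplacian s Ω '' {u | (u : L2 n) ∈ {v : L2 n | ∀ᵐ x ∂(volume.restrict Ω), ψ x ≤ v x}}
    have hconv : Convex ℝ Kset := by
      rintro _ ⟨u, hu, rfl⟩ _ ⟨v, hv, rfl⟩ a b ha hb hab
      refine ⟨a • u + b • v, ?_, by simp⟩
      show ∀ᵐ x ∂(volume.restrict Ω), ψ x ≤ (a • (u : L2 n) + b • (v : L2 n) : L2 n) x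
      filter_upwards [hu, hv, ae_restrict_of_ae (Lp.coeFn_add (a • (u : L2 n)) (b • (v : L2 n))),
        ae_restrict_of_ae (Lp.coeFn_smul a (u : L2 n)),
        ae_restrict_of_ae (Lp.coeFn_smul b (v : L2 n))] with x h1 h2 h3 h4 h5
      rw [h3, Pi.add_apply, h4, h5, Pi.smul_apply, Pi.smul_apply, smul_eq_mul, smul_eq_mul]
      calc ψ x = a * ψ x + b * ψ x := by rw [← add_mul, hab, one_mul]
        _ ≤ _ := by gcongr
    have hKne : Kset.Nonempty := by
      obtain ⟨v, hv, hv'⟩ := hne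
      exact ⟨_, ⟨v, hv⟩, hv', rfl⟩
    obtain ⟨g, ⟨u, hu, rfl⟩, hmin⟩ := exists_norm_eq_iInf_of_complete_convex hKne
      (isComplete_halfLaplacian_image hn hs0 hs1 hΩb (isClosed_setOf_ge Ω ψ)) hconv
      (halfLaplacian s Ω ω)
    rw [norm_eq_iInf_iff_real_inner_le_zero hconv ⟨u, hu, rfl⟩] at hmin
    refine ⟨u, (solvesObstacle_iff hω).2 ⟨⟨u.2, hu⟩, fun v hv => hmin _ ⟨v, hv.2, rfl⟩⟩⟩
  · intro u v hu hv
    have hu' : u ∈ hsTildeSubmodule s Ω := hu.1.1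
    have hv' : v ∈ hsTildeSubmodule s Ω := hv.1.1
    lift u to hsTildeSubmodule s Ω using hu'
    lift v to hsTildeSubmodule s Ω using hv'
    rw [solvesObstacle_iff hω] at hu hv
    have h1 := hu.2 v hv.1
    have h2 := hv.2 u hu.1
    set a := halfLaplacian s Ω ω
    set b := halfLaplacian s Ω u with hb
    set c := halfLaplacian s Ω v with hc
    have h3 : ‖c - b‖ ^ 2 ≤ 0 := by
      rw [← real_inner_self_eq_norm_sq]
      -- Testing each solution against the other and adding leaves ‖c - b‖² ≤ 0.
      have h4 : inner ℝ (c - b) (c - b) = inner ℝ (a - b) (c - b) + inner ℝ (a - c) (b - c) := by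
        rw [← neg_sub c b, inner_neg_right, ← sub_eq_add_neg, ← inner_sub_left]
        congr 1
        abel
      linarith
    have h5 : c - b = 0 := by
      rw [← norm_eq_zero]
      nlinarith [norm_nonneg (c - b)]
    have h6 : halfLaplacian s Ω v = halfLaplacian s Ω u := sub_eq_zero.1 h5
    rw [injective_halfLaplacian hn hs0 hs1 hΩb h6]

/-! ### Stampacchia's iteration -/

/-- Stampacchia's lemma. -/
theorem eq_zero_of_stampacchia {φ : ℝ → ℝ} {M V A r γ : ℝ} (hφ0 : ∀ k, 0 ≤ φ k)
    (hφ : ∀ k h, M ≤ k → k ≤ h → φ h ≤ φ k) (hV : 0 < V) (hM : φ M ≤ V) (hA : 0 ≤ A) (hr : 0 < r)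
    (hγ : 1 < γ) (hrec : ∀ k h, M ≤ k → k < h → φ h ≤ (A / (h - k)) ^ r * φ k ^ γ)
    {h : ℝ} (hh : M + 2 * (V ^ (γ - 1) * 2 ^ (r / (γ - 1))) ^ (1 / r) * A < h) : φ h = 0 := by
  have hγ' : 0 < γ - 1 := by linarith
  set B := V ^ (γ - 1) * 2 ^ (r / (γ - 1)) with hB
  have hB0 : 0 < B := by positivity
  -- For A = 0 the step length d would vanish, but one use of the recursion already gives 0.
  rcases hA.eq_or_lt with rfl | hA
  · have h1 := hrec M h le_rfl (by linarith)
    rw [zero_div, Real.zero_rpow hr.ne', zero_mul] at h1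
    exact le_antisymm h1 (hφ0 h)
  set d := 2 * B ^ (1 / r) * A with hd
  have hd0 : 0 < d := by positivity
  -- The choices ρ^{γ-1} 2^r = 1 and B⁻¹ V^{γ-1} = ρ make the bound φ ≤ V ρ^j pass along the levels
  -- M + d(1 - 2^{-j}), all below M + d.
  set ρ : ℝ := 2 ^ (-(r / (γ - 1))) with hρ
  have hρ0 : 0 < ρ := by positivity
  have hρ1 : ρ < 1 := Real.rpow_lt_one_of_one_lt_of_neg one_lt_two (by
    have : 0 < r / (γ - 1) := by positivity
    linarith)
  have hργ : ρ ^ (γ - 1) * 2 ^ r = 1 := by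
    rw [hρ, ← Real.rpow_mul (by norm_num), ← Real.rpow_add (by norm_num)]
    have : -(r / (γ - 1)) * (γ - 1) + r = 0 := by field_simp; ring
    rw [this, Real.rpow_zero]
  have hAd : (2 * A / d) ^ r = B⁻¹ := by
    have h1 : 2 * A / d = (B ^ (1 / r))⁻¹ := by rw [hd]; field_simp
    rw [h1, Real.inv_rpow (by positivity), ← Real.rpow_mul hB0.le, one_div_mul_cancel hr.ne',
      Real.rpow_one]
  have hBρ : B⁻¹ * V ^ (γ - 1) = ρ := by
    rw [hB, hρ, Real.rpow_neg (by norm_num)]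
    field_simp
  have hk : ∀ j : ℕ, φ (M + d * (1 - (1 / 2) ^ j)) ≤ V * ρ ^ j := by
    intro j
    induction j with
    | zero => simpa using hM
    | succ j ih =>
      have hj : (0 : ℝ) ≤ 1 - (1 / 2) ^ j := by
        rw [sub_nonneg]; exact pow_le_one₀ (by norm_num) (by norm_num)
      have hjd : 0 ≤ d * (1 - (1 / 2) ^ j) := mul_nonneg hd0.le hj
      have hdiff : M + d * (1 - (1 / 2) ^ (j + 1)) - (M + d * (1 - (1 / 2) ^ j)) =
          d / 2 * (1 / 2) ^ j := by ring
      have hpos : 0 < d / 2 * (1 / 2) ^ j := by positivity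
      have h1 := hrec (M + d * (1 - (1 / 2) ^ j)) (M + d * (1 - (1 / 2) ^ (j + 1)))
        (by linarith) (by linarith)
      rw [hdiff] at h1
      have h2 : A / (d / 2 * (1 / 2) ^ j) = 2 * A / d * 2 ^ j := by
        rw [one_div, inv_pow]; field_simp
      calc φ (M + d * (1 - (1 / 2) ^ (j + 1)))
          ≤ (A / (d / 2 * (1 / 2) ^ j)) ^ r * φ (M + d * (1 - (1 / 2) ^ j)) ^ γ := h1
        _ ≤ (A / (d / 2 * (1 / 2) ^ j)) ^ r * (V * ρ ^ j) ^ γ := by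
          have := hφ0 (M + d * (1 - (1 / 2) ^ j))
          gcongr
        _ = B⁻¹ * ((2 : ℝ) ^ r) ^ j * (V ^ γ * (ρ ^ γ) ^ j) := by
          rw [h2, Real.mul_rpow (by positivity) (by positivity), hAd,
            Real.mul_rpow hV.le (by positivity), Real.rpow_pow_comm two_pos.le r j,
            Real.rpow_pow_comm hρ0.le γ j]
        _ = (B⁻¹ * V ^ (γ - 1)) * V * (ρ ^ (γ - 1) * 2 ^ r) ^ j * ρ ^ j := by
          have e1 : V ^ γ = V ^ (γ - 1) * V := by
            rw [← Real.rpow_add_one hV.ne']; congr 1; ring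
          have e2 : ρ ^ γ = ρ ^ (γ - 1) * ρ := by
            rw [← Real.rpow_add_one hρ0.ne']; congr 1; ring
          rw [e1, e2]; ring
        _ = V * ρ ^ (j + 1) := by rw [hBρ, hργ]; ring
  have hle : ∀ j : ℕ, φ h ≤ V * ρ ^ j := fun j => by
    have hj : (0 : ℝ) ≤ 1 - (1 / 2) ^ j := by
      rw [sub_nonneg]; exact pow_le_one₀ (by norm_num) (by norm_num)
    have hj' : d * (1 - (1 / 2) ^ j) ≤ d := by
      have : (0 : ℝ) < (1 / 2) ^ j := by positivity
      nlinarith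
    exact (hφ _ h (by nlinarith) (by linarith)).trans (hk j)
  have hlim : Tendsto (fun j : ℕ => V * ρ ^ j) atTop (𝓝 0) := by
    simpa using (tendsto_pow_atTop_nhds_zero_of_lt_one hρ0.le hρ1).const_mul V
  exact le_antisymm (ge_of_tendsto' hlim hle) (hφ0 h)

/-! ### Truncations as test functions -/

theorem compLp_mem_hsTilde {n : ℕ} (hn : 1 ≤ n) {s : ℝ} (hs0 : 0 < s) (hs1 : s < 1)
    {Ω : Set (Rn n)} {F : ℝ → ℝ} (hF : LipschitzWith 1 F) (hF0 : F 0 = 0) {u : L2 n}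
    (hu : u ∈ HsTilde s Ω) : hF.compLp hF0 u ∈ HsTilde s Ω := by
  refine ⟨memHs_iff.2 ((energy_compLp_le hn hs0 hs1 hF hF0 u).trans_lt (memHs_iff.1 hu.1)), ?_⟩
  filter_upwards [hF.coeFn_compLp hF0 u, hu.2] with x h1 h2 hx
  rw [h1, Function.comp_apply, h2 hx, hF0]

theorem lipschitzWith_max_sub (k : ℝ) : LipschitzWith 1 fun x : ℝ => max (x - k) 0 :=
  LipschitzWith.max_const (LipschitzWith.of_dist_le_mul fun x y => by simp) 0

theorem lipschitzWith_reflection (k : ℝ) : LipschitzWith 1 fun x : ℝ => x - 2 * max (x - k) 0 := by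
  have h : (fun x : ℝ => x - 2 * max (x - k) 0) = fun x => k - |x - k| := by
    ext x
    rcases le_total x k with h | h
    · rw [max_eq_right (by linarith), abs_of_nonpos (by linarith)]; ring
    · rw [max_eq_left (by linarith), abs_of_nonneg (by linarith)]; ring
  rw [h]
  refine LipschitzWith.of_dist_le_mul fun x y => ?_
  rw [NNReal.coe_one, one_mul, Real.dist_eq, Real.dist_eq, sub_sub_sub_cancel_left]
  refine (abs_abs_sub_abs_le_abs_sub _ _).trans (le_of_eq ?_)
  rw [sub_sub_sub_cancel_right, abs_sub_comm]

/-- For `k ≥ 0` and `u ∈ H̃ˢ(Ω)`, the truncation `b = (u - k)⁺` satisfies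
`⟨(-Δ)^s b, b⟩ ≤ ⟨(-Δ)^s u, b⟩`. -/
theorem exists_truncation {n : ℕ} (hn : 1 ≤ n) {s : ℝ} (hs0 : 0 < s) (hs1 : s < 1)
    {Ω : Set (Rn n)} {k : ℝ} (hk : 0 ≤ k) (u : hsTildeSubmodule s Ω) :
    ∃ b : hsTildeSubmodule s Ω, (∀ᵐ x ∂(volume : Measure (Rn n)), (b : L2 n) x = max ((u : L2 n) x - k) 0) ∧
      ‖halfLaplacian s Ω b‖ ^ 2 ≤ inner ℝ (halfLaplacian s Ω u) (halfLaplacian s Ω b) := by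
  have h0 : max (0 - k) 0 = 0 := max_eq_right (by linarith)
  have h0' : (0 : ℝ) - 2 * max (0 - k) 0 = 0 := by rw [h0]; ring
  set b : hsTildeSubmodule s Ω := ⟨(lipschitzWith_max_sub k).compLp h0 u,
    compLp_mem_hsTilde hn hs0 hs1 (lipschitzWith_max_sub k) h0 u.2⟩
  have hb : (b : L2 n) =ᵐ[volume] fun x => max ((u : L2 n) x - k) 0 :=
    (lipschitzWith_max_sub k).coeFn_compLp h0 (u : L2 n)
  refine ⟨b, hb, ?_⟩
  have h1 : ((u - (2 : ℝ) • b : hsTildeSubmodule s Ω) : L2 n) =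
      (lipschitzWith_reflection k).compLp h0' u := by
    apply Lp.ext
    filter_upwards [hb, (lipschitzWith_reflection k).coeFn_compLp h0' (u : L2 n),
      Lp.coeFn_sub (u : L2 n) ((2 : ℝ) • (b : L2 n)), Lp.coeFn_smul (2 : ℝ) (b : L2 n)] with x h2 h3 h4 h5
    rw [h3, Submodule.coe_sub, Submodule.coe_smul, h4, Pi.sub_apply, h5, Pi.smul_apply, h2]
    rfl
  -- Folding does not raise the energy; expanding the square of u - 2b gives the claim.
  have h2 := energy_compLp_le hn hs0 hs1 (lipschitzWith_reflection k) h0' (u : L2 n)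
  rw [← h1, ← enorm_halfLaplacian_sq s Ω, ← enorm_halfLaplacian_sq s Ω, ← ofReal_norm, ← ofReal_norm,
    ← ENNReal.ofReal_pow (norm_nonneg _), ← ENNReal.ofReal_pow (norm_nonneg _),
    ENNReal.ofReal_le_ofReal_iff (by positivity), map_sub, map_smul, norm_sub_sq_real, norm_smul,
    inner_smul_right, mul_pow] at h2
  norm_num at h2
  linarith

/-- The competitor u + (ω - u)⁺ is admissible since it lies above u; testing with it shows that (ω -
u)⁺ has zero energy. -/
theorem solvesDirichlet_le_solvesObstacle {n : ℕ} (hn : 1 ≤ n) {s : ℝ} (hs0 : 0 < s) (hs1 : s < 1)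
    {Ω : Set (Rn n)} (hΩb : Bornology.IsBounded Ω) {ψ f : Rn n → ℝ} {ω u : L2 n}
    (hω : SolvesDirichlet s Ω f ω) (hu : SolvesObstacle s Ω ψ f u) :
    ∀ᵐ x ∂(volume : Measure (Rn n)), ω x ≤ u x := by
  have hωH : ω ∈ hsTildeSubmodule s Ω := hω.1
  have huH : u ∈ hsTildeSubmodule s Ω := hu.1.1
  lift ω to hsTildeSubmodule s Ω using hωH
  lift u to hsTildeSubmodule s Ω using huH
  rw [solvesObstacle_iff hω] at hu
  obtain ⟨b, hb, hbE⟩ := exists_truncation hn hs0 hs1 le_rfl (ω - u)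
  have hv : ((u + b : hsTildeSubmodule s Ω) : L2 n) ∈ obstacleSet s Ω ψ := by
    refine ⟨(u + b).2, ?_⟩
    filter_upwards [hu.1.2, ae_restrict_of_ae hb,
      ae_restrict_of_ae (Lp.coeFn_add (u : L2 n) (b : L2 n))] with x h1 h2 h3
    rw [Submodule.coe_add, h3, Pi.add_apply, h2]
    linarith [le_max_right (((ω - u : hsTildeSubmodule s Ω) : L2 n) x - 0) 0]
  have h1 := hu.2 _ hv
  rw [← map_sub, ← map_sub, add_sub_cancel_left] at h1
  have h2 : halfLaplacian s Ω b = 0 := by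
    rw [← norm_eq_zero]
    nlinarith [norm_nonneg (halfLaplacian s Ω b)]
  have h3 : b = 0 := injective_halfLaplacian hn hs0 hs1 hΩb (by rw [h2, map_zero])
  filter_upwards [hb, Lp.coeFn_sub (ω : L2 n) (u : L2 n), Lp.coeFn_zero ℝ 2 (volume : Measure (Rn n))]
    with x h4 h5 h6
  rw [h3, Submodule.coe_zero, h6, Submodule.coe_sub, h5, Pi.sub_apply] at h4
  have := le_max_left ((ω : L2 n) x - (u : L2 n) x - 0) 0
  rw [← h4, Pi.zero_apply] at this
  linarith

/-- The competitor u - b = min(u, k) stays above ψ because ψ ≤ k. -/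
theorem exists_truncation_solvesObstacle {n : ℕ} (hn : 1 ≤ n) {s : ℝ} (hs0 : 0 < s) (hs1 : s < 1)
    {Ω : Set (Rn n)} {ψ f : Rn n → ℝ} {ω u : hsTildeSubmodule s Ω}
    (hω : SolvesDirichlet s Ω f ω) (hu : SolvesObstacle s Ω ψ f u) {k : ℝ} (hk : 0 ≤ k)
    (hψ : ∀ᵐ x ∂(volume.restrict Ω), ψ x ≤ k) :
    ∃ b : hsTildeSubmodule s Ω, (∀ᵐ x ∂(volume : Measure (Rn n)), (b : L2 n) x = max ((u : L2 n) x - k) 0) ∧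
      ‖halfLaplacian s Ω b‖ ^ 2 ≤ pairing Ω f b := by
  rw [solvesObstacle_iff hω] at hu
  obtain ⟨b, hb, hbE⟩ := exists_truncation hn hs0 hs1 hk u
  refine ⟨b, hb, hbE.trans ?_⟩
  have hv : ((u - b : hsTildeSubmodule s Ω) : L2 n) ∈ obstacleSet s Ω ψ := by
    refine ⟨(u - b).2, ?_⟩
    filter_upwards [hu.1.2, hψ, ae_restrict_of_ae hb,
      ae_restrict_of_ae (Lp.coeFn_sub (u : L2 n) (b : L2 n))] with x h1 h2 h3 h4
    rw [Submodule.coe_sub, h4, Pi.sub_apply, h3]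
    rcases max_cases ((u : L2 n) x - k) 0 with h | h <;> linarith
  have h1 := hu.2 _ hv
  rw [← map_sub (halfLaplacian s Ω) (u - b), sub_sub_cancel_left, map_neg, inner_neg_right, inner_sub_left,
    inner_halfLaplacian s Ω ω b, hω.2 b b.2] at h1
  linarith

/-! ### The upper bound -/

/-- For b = (u - k)⁺, Hölder bounds its energy norm by ‖f⁺‖_p S m^β, with β = 1/p' - 1/r and m the
measure of {u > k}. Chebyshev in L^r, with b ≥ h - k on {u > h}, and βr = r/p' - 1 give the
recursion. -/
theorem measureReal_superlevel_le {n : ℕ} (hn : 1 ≤ n) {s : ℝ} (hs0 : 0 < s) (hs1 : s < 1)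
    {Ω : Set (Rn n)} (hΩb : Bornology.IsBounded Ω) {p r S : ℝ} (hp1 : 1 < p)
    (hr : p.conjExponent < r) (hS0 : 0 ≤ S)
    (hS : ∀ u : hsTildeSubmodule s Ω,
      eLpNorm (u : L2 n) (ENNReal.ofReal r) volume ≤ ENNReal.ofReal (S * ‖halfLaplacian s Ω u‖))
    {ψ f : Rn n → ℝ} (hf : MemLp f (ENNReal.ofReal p) (volume.restrict Ω))
    {ω u : hsTildeSubmodule s Ω}
    (hω : SolvesDirichlet s Ω f ω) (hu : SolvesObstacle s Ω ψ f u) {k h : ℝ} (hk : 0 ≤ k)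
    (hψ : ∀ᵐ x ∂(volume.restrict Ω), ψ x ≤ k) (hkh : k < h) :
    volume.real {x | h < (u : L2 n) x} ≤
      (S ^ 2 * normLp Ω (ENNReal.ofReal p) (fun y => max (f y) 0) / (h - k)) ^ r *
        volume.real {x | k < (u : L2 n) x} ^ (r / p.conjExponent - 1) := by
  obtain ⟨b, hb, hbE⟩ := exists_truncation_solvesObstacle hn hs0 hs1 hω hu hk hψ
  have hq0 := (Real.HolderConjugate.conjExponent hp1).symm.pos
  have hr0 : 0 < r := hq0.trans hr
  set N := normLp Ω (ENNReal.ofReal p) (fun y => max (f y) 0)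
  have hN : 0 ≤ N := ENNReal.toReal_nonneg
  have hfin : ∀ t : ℝ, 0 ≤ t → volume {x | t < (u : L2 n) x} ≠ ∞ := fun t ht => by
    refine ((measure_mono fun x hx => ?_).trans_lt
      ((volume_support_le hΩb u.2).trans_lt ENNReal.ofReal_lt_top)).ne
    have hx' : t < (u : L2 n) x := hx
    exact (ht.trans_lt hx').ne'
  set m := volume.real {x | k < (u : L2 n) x}
  have hm0 : 0 ≤ m := measureReal_nonneg
  have hbm : volume {x | (b : L2 n) x ≠ 0} ≤ ENNReal.ofReal m := by
    rw [ofReal_measureReal (hfin k hk)]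
    apply measure_mono_ae
    filter_upwards [hb] with x hx (h1 : (b : L2 n) x ≠ 0)
    show k < (u : L2 n) x
    by_contra h2
    rw [hx, max_eq_right (by linarith)] at h1
    exact h1 rfl
  have hfp : MemLp (fun y => max (f y) 0) (ENNReal.ofReal p) (volume.restrict Ω) := hf.pos_part
  obtain ⟨hint, hle⟩ := integrable_mul_and_integral_le hp1 hr.le hS0 hm0 (hS b) hbm hfp
  have hint' := (integrable_mul_and_integral_le hp1 hr.le hS0 hm0 (hS b) hbm hf).1
  set β := 1 / p.conjExponent - 1 / r with hβ
  have hpair : pairing Ω f b ≤ ∫ x in Ω, |max (f x) 0 * (b : L2 n) x| := by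
    refine integral_mono_ae hint' hint.abs (ae_restrict_of_ae ?_)
    filter_upwards [hb] with x hx
    have hbx : 0 ≤ (b : L2 n) x := by rw [hx]; exact le_max_right _ _
    exact (mul_le_mul_of_nonneg_right (le_max_left _ _) hbx).trans (le_abs_self _)
  have hT : ‖halfLaplacian s Ω b‖ ≤ N * S * m ^ β := by
    have h1 := hbE.trans (hpair.trans hle)
    rcases (norm_nonneg (halfLaplacian s Ω b)).eq_or_lt with h2 | h2
    · rw [← h2]; positivity
    · refine le_of_mul_le_mul_right ?_ h2
      calc _ = ‖halfLaplacian s Ω b‖ ^ 2 := by ring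
        _ ≤ _ := h1
        _ = _ := by ring
  have hcheb : ENNReal.ofReal (h - k) ^ r * volume {x | h < (u : L2 n) x} ≤
      ENNReal.ofReal (S * ‖halfLaplacian s Ω b‖) ^ r := by
    have h1 := mul_meas_ge_le_pow_eLpNorm' volume (p := ENNReal.ofReal r) (by simpa using hr0)
      ENNReal.ofReal_ne_top (Lp.aestronglyMeasurable (b : L2 n)) (ENNReal.ofReal (h - k))
    rw [ENNReal.toReal_ofReal hr0.le] at h1
    refine (mul_le_mul_right (measure_mono_ae ?_) _).trans
      (h1.trans (ENNReal.rpow_le_rpow (hS b) hr0.le))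
    filter_upwards [hb] with x hx (h2 : h < (u : L2 n) x)
    show ENNReal.ofReal (h - k) ≤ ‖(b : L2 n) x‖ₑ
    rw [hx, ← ofReal_norm, Real.norm_eq_abs]
    apply ENNReal.ofReal_le_ofReal
    exact le_trans (by linarith [le_max_left ((u : L2 n) x - k) 0]) (le_abs_self _)
  have hhk : 0 < h - k := by linarith
  rw [← ofReal_measureReal (hfin h (hk.trans hkh.le)), ENNReal.ofReal_rpow_of_nonneg hhk.le hr0.le,
    ENNReal.ofReal_rpow_of_nonneg (by positivity) hr0.le, ← ENNReal.ofReal_mul (by positivity),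
    ENNReal.ofReal_le_ofReal_iff (by positivity)] at hcheb
  have hβr : β * r = r / p.conjExponent - 1 := by rw [hβ]; field_simp
  calc volume.real {x | h < (u : L2 n) x}
      ≤ (S * ‖halfLaplacian s Ω b‖) ^ r / (h - k) ^ r := by
        rw [le_div_iff₀ (by positivity), mul_comm]; exact hcheb
    _ ≤ (S * (N * S * m ^ β)) ^ r / (h - k) ^ r := by gcongr
    _ = (S ^ 2 * N / (h - k) * m ^ β) ^ r := by
        rw [← Real.div_rpow (by positivity) hhk.le]; congr 1; ring
    _ = _ := by
        rw [Real.mul_rpow (by positivity) (by positivity), ← Real.rpow_mul hm0, hβr]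

/-- A priori bound from above for the solution of the obstacle problem. -/
theorem exists_solvesObstacle_le {n : ℕ} (hn : 1 ≤ n) {s : ℝ} (hs0 : 0 < s) (hs1 : s < 1)
    {Ω : Set (Rn n)} (hΩb : Bornology.IsBounded Ω) {p : ℝ} (hp1 : 1 < p) (hp : (n : ℝ) / (2 * s) < p) :
    ∃ c : ℝ, 0 ≤ c ∧ ∀ (ψ f : Rn n → ℝ) (ω u : L2 n) (M : ℝ),
      MemLp f (ENNReal.ofReal p) (volume.restrict Ω) → SolvesDirichlet s Ω f ω →
      SolvesObstacle s Ω ψ f u → 0 ≤ M → (∀ᵐ x ∂(volume.restrict Ω), ψ x ≤ M) →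
      ∀ᵐ x ∂(volume : Measure (Rn n)),
        u x ≤ M + c * normLp Ω (ENNReal.ofReal p) (fun y => max (f y) 0) := by
  obtain ⟨r, S, hr, hS0, hS⟩ := exists_sobolev hn hs0 hs1 hΩb hp1 hp
  have hq0 := (Real.HolderConjugate.conjExponent hp1).symm.pos
  set V := closureVolume Ω
  have hV : 0 < V := closureVolume_pos Ω
  have hγ : 1 < r / p.conjExponent - 1 := by
    have : 2 < r / p.conjExponent := by rwa [lt_div_iff₀ hq0]
    linarith
  set γ := r / p.conjExponent - 1
  -- Stampacchia's threshold with A = S²‖f⁺‖_p is linear in ‖f⁺‖_p; c is the remaining factor,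
  -- independent of ψ and f.
  refine ⟨2 * (V ^ (γ - 1) * 2 ^ (r / (γ - 1))) ^ (1 / r) * S ^ 2, by positivity,
    fun ψ f ω u M hf hω hu hM hψ => ?_⟩
  have hωH : ω ∈ hsTildeSubmodule s Ω := hω.1
  have huH : u ∈ hsTildeSubmodule s Ω := hu.1.1
  lift ω to hsTildeSubmodule s Ω using hωH
  lift u to hsTildeSubmodule s Ω using huH
  set N := normLp Ω (ENNReal.ofReal p) (fun y => max (f y) 0)
  have hN : 0 ≤ N := ENNReal.toReal_nonneg
  have hsub : ∀ t : ℝ, 0 ≤ t → volume {x | t < (u : L2 n) x} ≤ ENNReal.ofReal V := fun t ht => by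
    refine (measure_mono fun x hx => ?_).trans (volume_support_le hΩb u.2)
    have hx' : t < (u : L2 n) x := hx
    exact (ht.trans_lt hx').ne'
  have hzero : ∀ h : ℝ, M + 2 * (V ^ (γ - 1) * 2 ^ (r / (γ - 1))) ^ (1 / r) * (S ^ 2 * N) < h →
      volume.real {x | h < (u : L2 n) x} = 0 := fun h hh =>
    eq_zero_of_stampacchia (φ := fun t => volume.real {x | t < (u : L2 n) x})
      (fun k => measureReal_nonneg)
      (fun k h hk hkh => measureReal_mono (fun x hx => lt_of_le_of_lt hkh hx)
        ((hsub k (hM.trans hk)).trans_lt ENNReal.ofReal_lt_top).ne)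
      hV (ENNReal.toReal_le_of_le_ofReal hV.le (hsub M hM)) (by positivity) (by linarith) hγ
      (fun k h hk hkh => measureReal_superlevel_le hn hs0 hs1 hΩb hp1 (by linarith) hS0 hS hf hω hu
        (hM.trans hk) (hψ.mono fun x hx => hx.trans hk) hkh) hh
  rw [mul_assoc _ (S ^ 2) N]
  set d := M + 2 * (V ^ (γ - 1) * 2 ^ (r / (γ - 1))) ^ (1 / r) * (S ^ 2 * N)
  have hd : 0 ≤ d := by positivity
  -- Only levels strictly above d are known to be null, so d is approached by countably many of
  -- them.
  have hae : ∀ᵐ x ∂(volume : Measure (Rn n)), ∀ j : ℕ, (u : L2 n) x ≤ d + 1 / ((j : ℝ) + 1) := by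
    rw [ae_all_iff]
    intro j
    have hj : (0 : ℝ) < 1 / ((j : ℝ) + 1) := by positivity
    have h1 := hzero (d + 1 / ((j : ℝ) + 1)) (by linarith)
    rw [measureReal_eq_zero_iff ((hsub _ (by positivity)).trans_lt ENNReal.ofReal_lt_top).ne] at h1
    rw [ae_iff]
    simpa only [not_le] using h1
  filter_upwards [hae] with x hx
  have hlim : Tendsto (fun j : ℕ => d + 1 / ((j : ℝ) + 1)) atTop (𝓝 d) := by
    simpa using (tendsto_one_div_add_atTop_nhds_zero_nat (𝕜 := ℝ)).const_add d
  exact ge_of_tendsto' hlim hx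

theorem ae_le_normLp_top {n : ℕ} {Ω : Set (Rn n)} {g : Rn n → ℝ} (hg : MemLp g ∞ (volume.restrict Ω)) :
    ∀ᵐ x ∂(volume.restrict Ω), |g x| ≤ normLp Ω ∞ g := by
  have h1 := hg.2
  rw [eLpNorm_exponent_top] at h1
  filter_upwards [ae_le_eLpNormEssSup (f := g) (μ := volume.restrict Ω)] with x hx
  rw [normLp, eLpNorm_exponent_top, ← Real.norm_eq_abs, ← toReal_enorm]
  exact ENNReal.toReal_mono h1.ne hx

end FracObstacle

end

/-! ### Assembly -/

theorem corollaryC (n : ℕ) (hn : 1 ≤ n) (s : ℝ) (hs0 : 0 < s) (hs1 : s < 1)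
    (Ω : Set (FracObstacle.Rn n)) (hΩo : IsOpen Ω) (hΩc : IsConnected Ω)
    (hΩb : Bornology.IsBounded Ω)
    (p : ℝ) (hp1 : 1 < p) (hp : (n : ℝ) / (2 * s) < p) :
    ∃ c : ℝ, 0 ≤ c ∧
      ∀ ψ f : FracObstacle.Rn n → ℝ,
        MemLp ψ ∞ (volume.restrict Ω) →
        MemLp f (ENNReal.ofReal p) (volume.restrict Ω) →
        (FracObstacle.obstacleSet s Ω ψ).Nonempty →
        FracObstacle.MemDual s Ω f ∧
        (∃! ω : FracObstacle.L2 n, FracObstacle.SolvesDirichlet s Ω f ω) ∧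
        (∃! u : FracObstacle.L2 n, FracObstacle.SolvesObstacle s Ω ψ f u) ∧
        ∀ ω u : FracObstacle.L2 n,
          FracObstacle.SolvesDirichlet s Ω f ω →
          FracObstacle.SolvesObstacle s Ω ψ f u →
            MemLp u ∞ (volume.restrict Ω) ∧
            (∀ᵐ x ∂(volume.restrict Ω),
              max (ψ x) (ω x) ≤ u x ∧
              u x ≤ FracObstacle.normLp Ω ∞ (fun y => max (ψ y) 0)
                + c * FracObstacle.normLp Ω (ENNReal.ofReal p) (fun y => max (f y) 0)) ∧
            (f =ᵐ[volume.restrict Ω] 0 →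
              ∀ᵐ x ∂(volume.restrict Ω),
                max (ψ x) 0 ≤ u x ∧
                u x ≤ FracObstacle.normLp Ω ∞ (fun y => max (ψ y) 0)) := by
  obtain ⟨c, hc0, hc⟩ := FracObstacle.exists_solvesObstacle_le hn hs0 hs1 hΩb hp1 hp
  refine ⟨c, hc0, fun ψ f hψ hf hne => ?_⟩
  have hdual := FracObstacle.memDual_of_memLp hn hs0 hs1 hΩb hp1 hp hf
  refine ⟨hdual, FracObstacle.existsUnique_solvesDirichlet hn hs0 hs1 hΩb hdual,
    FracObstacle.existsUnique_solvesObstacle hn hs0 hs1 hΩb hdual hne, fun ω u hω hu => ?_⟩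
  have hψp : MemLp (fun y => max (ψ y) 0) ∞ (volume.restrict Ω) := hψ.pos_part
  have hψM : ∀ᵐ x ∂(volume.restrict Ω), ψ x ≤ FracObstacle.normLp Ω ∞ (fun y => max (ψ y) 0) := by
    filter_upwards [FracObstacle.ae_le_normLp_top hψp] with x hx
    exact (le_max_left _ _).trans ((le_abs_self _).trans hx)
  have hupper := ae_restrict_of_ae (s := Ω) (hc ψ f ω u _ hf hω hu ENNReal.toReal_nonneg hψM)
  have hlower := ae_restrict_of_ae (s := Ω)
    (FracObstacle.solvesDirichlet_le_solvesObstacle hn hs0 hs1 hΩb hω hu)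
  refine ⟨?_, ?_, fun hf0 => ?_⟩
  · refine memLp_top_of_bound (Lp.aestronglyMeasurable u).restrict
      (max (FracObstacle.normLp Ω ∞ ψ) (FracObstacle.normLp Ω ∞ (fun y => max (ψ y) 0)
        + c * FracObstacle.normLp Ω (ENNReal.ofReal p) (fun y => max (f y) 0))) ?_
    filter_upwards [hupper, hu.1.2, FracObstacle.ae_le_normLp_top hψ] with x h1 h2 h3
    rw [Real.norm_eq_abs, abs_le]
    refine ⟨?_, h1.trans (le_max_right _ _)⟩
    have h4 := le_max_left (FracObstacle.normLp Ω ∞ ψ) (FracObstacle.normLp Ω ∞ (fun y => max (ψ y) 0)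
        + c * FracObstacle.normLp Ω (ENNReal.ofReal p) (fun y => max (f y) 0))
    linarith [(abs_le.1 h3).1]
  · filter_upwards [hupper, hu.1.2, hlower] with x h1 h2 h3
    exact ⟨max_le h2 h3, h1⟩
  -- If f = 0 then ω tested against itself has zero energy, so the lower barrier max(ψ, ω) becomes
  -- ψ⁺.
  · have hω0 : ω = 0 := by
      refine FracObstacle.eq_zero_of_fracForm_self hn hs0 hs1 hΩb hω.1 (le_of_eq ?_)
      rw [hω.2 ω hω.1, FracObstacle.pairing]
      refine (integral_congr_ae ?_).trans (integral_zero _ _)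
      filter_upwards [hf0] with x hx
      rw [hx, Pi.zero_apply, zero_mul]
    have hN : FracObstacle.normLp Ω (ENNReal.ofReal p) (fun y => max (f y) 0) = 0 := by
      have h1 : (fun y => max (f y) 0) =ᵐ[volume.restrict Ω] 0 := by
        filter_upwards [hf0] with x hx
        rw [hx, Pi.zero_apply, max_self]
      rw [FracObstacle.normLp, eLpNorm_congr_ae h1, eLpNorm_zero, ENNReal.toReal_zero]
    rw [hN, mul_zero, add_zero] at hupper
    have hzero := ae_restrict_of_ae (s := Ω) (Lp.coeFn_zero ℝ 2 (volume : Measure (FracObstacle.Rn n)))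
    filter_upwards [hupper, hu.1.2, hlower, hzero] with x h1 h2 h3 h4
    rw [hω0, h4, Pi.zero_apply] at h3
    exact ⟨max_le h2 h3, h1⟩
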